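/- A \emph{term} over variables $x_1,\dots,x_n$ is a conjunction of literals, and a \emph{DNF} is a disjunction $T_1\vee\dots\vee T_s$ of finitely many terms; it is regarded as a function $f:\{-1,1\}^n\to\{0,1\}$, where an input value $-1$ means true, an input value $1$ means false, and the output is $1$ if the formula is satisfied and $0$ otherwise. The DNF has \emph{width} $w$ if each term contains at most $w$ variables, and \emph{read} $k$ if each variable occurs in at most $k$ terms. For $S\subseteq\{1,\dots,n\}$ let $\hat f(S)=2^{-n}\sum_{x\in\{-1,1\}^n} f(x)\prod_{i\in S}x_i$. The function $f$ is \emph{$\varepsilon$-concentrated on $M$ coefficients} if there is a family $\mathcal S$ of subsets of $\{1,\dots,n\}$ with $|\mathcal S|\le M$ and $\sum_{S\notin\mathcal S}\hat f(S)^2\le\varepsilon$. \textbf{Theorem.} There is an absolute constant $C>0$ such that for all integers $n,w,k\ge 0$, every $\varepsilon\in(0,1]$, and every width-$w$, read-$k$ DNF $f$ on $n$ variables, $f$ is $\varepsilon$-concentrated on $$\bigl(\log_2(k+2)\bigr)^{C\,w\,\log_2(1/\varepsilon)}$$ coefficients. -/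

import Mathlib

/-- A point of the cube `{-1, 1}^n`; the value `-1` stands for "true" and `1` for "false". -/
abbrev Cube (n : ℕ) : Type := Fin n → ℤˣ

/-- The monomial `x^S = ∏ i ∈ S, x_i`. -/
def monomialOn {n : ℕ} (S : Finset (Fin n)) (x : Cube n) : ℝ :=
  ∏ i ∈ S, (((x i : ℤˣ) : ℤ) : ℝ)

/-- The Fourier coefficient of `f` at `S`: the mean of `f x * x^S` over a uniform `x`. -/
noncomputable def fourierCoef {n : ℕ} (f : Cube n → ℝ) (S : Finset (Fin n)) : ℝ :=
  (∑ x : Cube n, f x * monomialOn S x) / 2 ^ n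

/-- `f` is `ε`-concentrated on the family `𝒮`: the Fourier weight outside `𝒮` is at most `ε`. -/
def ConcentratedOnFamily {n : ℕ} (f : Cube n → ℝ) (ε : ℝ) (𝒮 : Finset (Finset (Fin n))) : Prop :=
  ∑ S ∈ 𝒮ᶜ, fourierCoef f S ^ 2 ≤ ε

/-- `f` is `ε`-concentrated on `M` coefficients (`M` a real number). -/
def ConcentratedOnCoefs {n : ℕ} (f : Cube n → ℝ) (ε M : ℝ) : Prop :=
  ∃ 𝒮 : Finset (Finset (Fin n)), (𝒮.card : ℝ) ≤ M ∧ ConcentratedOnFamily f ε 𝒮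

/-- A term: a conjunction of literals. The literal `(i, b)` asserts `x_i = b`, so `(i, -1)` is the
variable `x_i` and `(i, 1)` is its negation. -/
abbrev DNFTerm (n : ℕ) : Type := Finset (Fin n × ℤˣ)

/-- The set of variables which a term queries. -/
def DNFTerm.vars {n : ℕ} (T : DNFTerm n) : Finset (Fin n) := T.image Prod.fst

/-- The input `x` satisfies every literal of the term. -/
def DNFTerm.Sat {n : ℕ} (T : DNFTerm n) (x : Cube n) : Prop := ∀ l ∈ T, x l.1 = l.2

/-- A DNF formula `T_1 ∨ ⋯ ∨ T_s`, as the list of its terms. -/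
abbrev DNFFormula (n : ℕ) : Type := List (DNFTerm n)

/-- The input `x` satisfies some term of the formula. -/
def DNFFormula.Sat {n : ℕ} (F : DNFFormula n) (x : Cube n) : Prop := ∃ T ∈ F, T.Sat x

open Classical in
/-- The function `{-1, 1}^n → {0, 1}` computed by the formula (`1` is "true", `0` is "false"). -/
noncomputable def DNFFormula.toFun {n : ℕ} (F : DNFFormula n) (x : Cube n) : ℝ :=
  if F.Sat x then 1 else 0

/-- The formula has width (at most) `w`: every term queries at most `w` variables. -/
def DNFFormula.HasWidth {n : ℕ} (F : DNFFormula n) (w : ℕ) : Prop :=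
  ∀ T ∈ F, T.vars.card ≤ w

/-- The formula has read (at most) `k`: every variable occurs in at most `k` of the terms,
counted with multiplicity. -/
def DNFFormula.HasRead {n : ℕ} (F : DNFFormula n) (k : ℕ) : Prop :=
  ∀ i : Fin n, F.countP (fun T => decide (i ∈ T.vars)) ≤ k

open Finset

namespace DNFConc

/-! Let `h = 1 - f` be the negation of the DNF and `t = log (1/ε)`. If `h` has variance at most `ε`,
the empty set alone suffices; so assume in particular that `h = 1` with probability more than `ε`.
The aim is a function `g` with `‖h - g‖₂² ≤ ε/8` and `∑ p^|S| |ĝ(S)| ≤ exp(O(w t))`, where `p =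
1/(16 r)` and `r = O(log k)`. As the Fourier weight of `h` above degree `D = O(w t)` is small, only
`|S| ≤ D` matters; there the coefficients of `g` have absolute sum at most `exp(O(w t)) p^(-D) =
(log k)^(O(w t))`, and the large ones form the required family (`exists_family`).

Both the tail bound and the damped norm bound start from one switching lemma (`switching`): under a
restriction with free probability `1/(16 r)`, a width-`r` DNF has bounded mean for every functional
that is subadditive under splitting the cube by a coordinate. The choice `N g = ∑ 2^|S| ĝ(S)²` with
`r = w` gives exponential decay of the tail at scale `w`; the choice `N g = ∑ |ĝ(S)|` gives damped
norm at most 2 for width `r`.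

Terms wider than `r` are peeled off one at a time (`pnorm_negF_chain`). Multiplication by a term of
width `u` costs a factor `((1+p)/2)^u`, and fixing its variables alters at most `u k` other terms,
each of which shrinks to width `r` for free or still costs at most `γ^r`. With `r` of order `log k`
this is negligible, and the norm is at most `2 exp(∑ γ^|V i|)`, where `γ = 11/20` is slightly above
`1/2`.

That sum may still be too large. Since `h = 1` has probability more than `ε`, terms of width at most
`u` have total probability at most `k u t` (`avg_negF_le_exp`), which handles all terms below a
width `w0` of order `log (k w)`. For the terms of width at least `w0`, `h` is written as a product
over "leaders", that is, satisfied terms with no earlier satisfied neighbour. Simultaneous leaders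
have disjoint variables, and leader events are weakly dependent. Because no leader occurs with
probability more than `ε`, the expected number of leaders is `O(t)`, and so is the exponent of its
moment generating function. Hence inclusion-exclusion over leaders may be truncated at order `O(t)`
(`truncation_sq_le`), and the truncated sum has small damped norm (`exists_approx`). -/

/-! ### Fourier coefficients under restriction of one coordinate -/

/-- Restriction of one coordinate. -/
def setc {n : ℕ} (g : Cube n → ℝ) (i : Fin n) (b : ℤˣ) : Cube n → ℝ :=
  fun x => g (Function.update x i b)

theorem sum_setc {n : ℕ} (g : Cube n → ℝ) (i : Fin n) :
    ∑ x, setc g i 1 x + ∑ x, setc g i (-1) x = 2 * ∑ x, g x := by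
  have hinv : Function.Involutive (fun x : Cube n => Function.update x i (-(x i))) := by
    intro x; simp
  have h1 : ∑ x : Cube n, g (Function.update x i (-(x i))) = ∑ x, g x :=
    Equiv.sum_comp hinv.toPerm g
  rw [← sum_add_distrib, two_mul]
  nth_rewrite 2 [← h1]
  rw [← sum_add_distrib]
  refine sum_congr rfl fun x _ => ?_
  unfold setc
  rcases Int.units_eq_one_or (x i) with h | h
  · have : Function.update x i 1 = x := by rw [← h]; simp
    rw [this, h]
  · have : Function.update x i (-1) = x := by rw [← h]; simp
    rw [this, h, neg_neg, add_comm]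

theorem monomialOn_update {n : ℕ} {S : Finset (Fin n)} {i : Fin n} (hi : i ∉ S) (x : Cube n)
    (b : ℤˣ) : monomialOn S (Function.update x i b) = monomialOn S x := by
  unfold monomialOn
  refine prod_congr rfl fun j hj => ?_
  rw [Function.update_of_ne (by rintro rfl; exact hi hj)]

theorem monomialOn_insert_update {n : ℕ} {S : Finset (Fin n)} {i : Fin n} (hi : i ∉ S)
    (x : Cube n) (b : ℤˣ) :
    monomialOn (insert i S) (Function.update x i b) = ((b : ℤ) : ℝ) * monomialOn S x := by
  have h : monomialOn (insert i S) (Function.update x i b) =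
      (((Function.update x i b i : ℤˣ) : ℤ) : ℝ) * monomialOn S (Function.update x i b) := by
    unfold monomialOn
    rw [prod_insert hi]
  rw [h, monomialOn_update hi, Function.update_self]

theorem fourierCoef_half {n : ℕ} (g : Cube n → ℝ) (S : Finset (Fin n)) (i : Fin n) :
    fourierCoef g S = ((∑ x, setc (fun x => g x * monomialOn S x) i 1 x) / 2 ^ n +
      (∑ x, setc (fun x => g x * monomialOn S x) i (-1) x) / 2 ^ n) / 2 := by
  rw [← add_div, sum_setc]; unfold fourierCoef; ring

theorem fourierCoef_eq_setc {n : ℕ} (g : Cube n → ℝ) {S : Finset (Fin n)} {i : Fin n}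
    (hi : i ∉ S) :
    fourierCoef g S = (fourierCoef (setc g i 1) S + fourierCoef (setc g i (-1)) S) / 2 := by
  rw [fourierCoef_half g S i]
  unfold fourierCoef setc
  simp only [monomialOn_update hi]

theorem fourierCoef_insert_eq_setc {n : ℕ} (g : Cube n → ℝ) {S : Finset (Fin n)} {i : Fin n}
    (hi : i ∉ S) : fourierCoef g (insert i S) =
      (fourierCoef (setc g i 1) S - fourierCoef (setc g i (-1)) S) / 2 := by
  rw [fourierCoef_half g _ i]
  unfold fourierCoef setc
  simp only [monomialOn_insert_update hi]
  simp [sum_neg_distrib]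
  ring

theorem setc_setc {n : ℕ} (g : Cube n → ℝ) (i : Fin n) (b c : ℤˣ) :
    setc (setc g i b) i c = setc g i b := by
  funext x; simp [setc]

theorem fourierCoef_setc_insert {n : ℕ} (g : Cube n → ℝ) {S : Finset (Fin n)} {i : Fin n}
    (hi : i ∉ S) (b : ℤˣ) : fourierCoef (setc g i b) (insert i S) = 0 := by
  rw [fourierCoef_insert_eq_setc _ hi, setc_setc, setc_setc]; simp

theorem fourierCoef_setc_one {n : ℕ} (g : Cube n → ℝ) {S : Finset (Fin n)} {i : Fin n}
    (hi : i ∉ S) :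
    fourierCoef (setc g i 1) S = fourierCoef g S + fourierCoef g (insert i S) := by
  rw [fourierCoef_eq_setc g hi, fourierCoef_insert_eq_setc g hi]; ring

theorem fourierCoef_setc_neg_one {n : ℕ} (g : Cube n → ℝ) {S : Finset (Fin n)} {i : Fin n}
    (hi : i ∉ S) :
    fourierCoef (setc g i (-1)) S = fourierCoef g S - fourierCoef g (insert i S) := by
  rw [fourierCoef_eq_setc g hi, fourierCoef_insert_eq_setc g hi]; ring

theorem sum_finset_split {n : ℕ} (F : Finset (Fin n) → ℝ) (i : Fin n) :
    ∑ S, F S = ∑ S ∈ (univ.erase i).powerset, (F S + F (insert i S)) := by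
  have h := sum_powerset_insert (notMem_erase i univ) F
  rw [insert_erase (mem_univ i), powerset_univ] at h
  rw [h, sum_add_distrib]

/-! ### Weighted Fourier sums and one-coordinate inequalities -/

/-- Weighted sum of `φ` over the Fourier coefficients. -/
noncomputable def wsum {n : ℕ} (φ : ℝ → ℝ) (c : Fin n → ℝ) (g : Cube n → ℝ) : ℝ :=
  ∑ S, (∏ i ∈ S, c i) * φ (fourierCoef g S)

theorem wsum_split {n : ℕ} (φ : ℝ → ℝ) (c : Fin n → ℝ) (g : Cube n → ℝ) (i : Fin n) :
    wsum φ c g = ∑ S ∈ (univ.erase i).powerset, (∏ j ∈ S, c j) *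
      (φ (fourierCoef g S) + c i * φ (fourierCoef g (insert i S))) := by
  unfold wsum
  rw [sum_finset_split _ i]
  refine sum_congr rfl fun S hS => ?_
  have hi : i ∉ S := fun h => by simpa using (mem_powerset.1 hS) h
  rw [prod_insert hi]; ring

theorem wsum_setc {n : ℕ} (φ : ℝ → ℝ) (h0 : φ 0 = 0) (c : Fin n → ℝ) (g : Cube n → ℝ)
    (i : Fin n) (b : ℤˣ) :
    wsum φ c (setc g i b) = ∑ S ∈ (univ.erase i).powerset, (∏ j ∈ S, c j) *
      φ (fourierCoef (setc g i b) S) := by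
  rw [wsum_split φ c _ i]
  refine sum_congr rfl fun S hS => ?_
  have hi : i ∉ S := fun h => by simpa using (mem_powerset.1 hS) h
  rw [fourierCoef_setc_insert g hi, h0]; ring

/-- Averaging over a restriction of one coordinate changes the weight of this coordinate. -/
theorem wsum_step {n : ℕ} (φ : ℝ → ℝ) (h0 : φ 0 = 0) (p d : ℝ) (c : Fin n → ℝ)
    (hc : ∀ i, 0 ≤ c i) (g : Cube n → ℝ) (i : Fin n)
    (hφ : ∀ a b, φ a + d * φ b ≤
      p * (φ a + c i * φ b) + (1 - p) / 2 * (φ (a + b) + φ (a - b))) :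
    wsum φ (Function.update c i d) g ≤
      p * wsum φ c g + (1 - p) / 2 * (wsum φ c (setc g i 1) + wsum φ c (setc g i (-1))) := by
  rw [wsum_split φ _ g i, wsum_split φ c g i, wsum_setc φ h0, wsum_setc φ h0,
    ← sum_add_distrib, mul_sum, mul_sum, ← sum_add_distrib]
  refine sum_le_sum fun S hS => ?_
  have hi : i ∉ S := fun h => by simpa using (mem_powerset.1 hS) h
  have hp : ∏ j ∈ S, Function.update c i d j = ∏ j ∈ S, c j :=
    prod_congr rfl fun j hj => Function.update_of_ne (by rintro rfl; exact hi hj) _ _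
  rw [hp, Function.update_self, fourierCoef_setc_one g hi, fourierCoef_setc_neg_one g hi]
  have := mul_le_mul_of_nonneg_left (hφ (fourierCoef g S) (fourierCoef g (insert i S)))
    (prod_nonneg fun j (_ : j ∈ S) => hc j)
  linarith

/-- A weighted sum is at most the sum of the weighted sums over the two halves of the cube. -/
theorem wsum_le_setc {n : ℕ} (φ : ℝ → ℝ) (h0 : φ 0 = 0) (c : Fin n → ℝ)
    (hc : ∀ i, 0 ≤ c i) (g : Cube n → ℝ) (i : Fin n)
    (hφ : ∀ a b, φ a + c i * φ b ≤ φ (a + b) + φ (a - b)) :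
    wsum φ c g ≤ wsum φ c (setc g i 1) + wsum φ c (setc g i (-1)) := by
  rw [wsum_split φ c g i, wsum_setc φ h0, wsum_setc φ h0, ← sum_add_distrib]
  refine sum_le_sum fun S hS => ?_
  have hi : i ∉ S := fun h => by simpa using (mem_powerset.1 hS) h
  rw [fourierCoef_setc_one g hi, fourierCoef_setc_neg_one g hi, ← mul_add]
  exact mul_le_mul_of_nonneg_left (hφ _ _) (prod_nonneg fun j _ => hc j)

/-! ### Random restrictions -/

/-- The weight of a symbol of a random restriction: `none` is a free variable. -/
noncomputable def rwt (p : ℝ) : Option ℤˣ → ℝ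
  | none => p
  | some _ => (1 - p) / 2

/-- The mean of `Φ` over a `p`-random restriction. -/
noncomputable def rE {n : ℕ} (p : ℝ) (Φ : (Fin n → Option ℤˣ) → ℝ) : ℝ :=
  ∑ ρ : Fin n → Option ℤˣ, (∏ i, rwt p (ρ i)) * Φ ρ

theorem sum_rwt (p : ℝ) (G : Option ℤˣ → ℝ) :
    ∑ c, rwt p c * G c = p * G none + (1 - p) / 2 * G (some 1) + (1 - p) / 2 * G (some (-1)) := by
  rw [Fintype.sum_option]
  have : (univ : Finset ℤˣ) = {1, -1} := rfl
  rw [this, sum_pair (by decide)]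
  simp [rwt]; ring

theorem rE_split {n : ℕ} (p : ℝ) (Φ : (Fin n → Option ℤˣ) → ℝ) (i : Fin n) :
    rE p Φ = ∑ ρ : {j // j ≠ i} → Option ℤˣ, (∏ j, rwt p (ρ j)) *
      ∑ c, rwt p c * Φ ((Equiv.funSplitAt i _).symm (c, ρ)) := by
  unfold rE
  rw [← Equiv.sum_comp (Equiv.funSplitAt i (Option ℤˣ)).symm, Fintype.sum_prod_type_right]
  refine sum_congr rfl fun ρ _ => ?_
  rw [mul_sum]
  refine sum_congr rfl fun c _ => ?_
  have : ∏ j, rwt p ((Equiv.funSplitAt i (Option ℤˣ)).symm (c, ρ) j) =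
      rwt p c * ∏ j, rwt p (ρ j) := by
    rw [Fintype.prod_eq_mul_prod_subtype_ne _ i]
    congr 1
    · simp
    · refine prod_congr rfl fun j _ => ?_
      simp [Equiv.funSplitAt, Equiv.piSplitAt, j.2]
  rw [this]; ring

theorem update_funSplitAt {n : ℕ} (i : Fin n) (c d : Option ℤˣ) (ρ : {j // j ≠ i} → Option ℤˣ) :
    Function.update ((Equiv.funSplitAt i (Option ℤˣ)).symm (c, ρ)) i d =
      (Equiv.funSplitAt i (Option ℤˣ)).symm (d, ρ) := by
  funext j
  by_cases h : j = i
  · subst h; simp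
  · simp [Equiv.funSplitAt, Equiv.piSplitAt, h]

theorem rE_step {n : ℕ} (p : ℝ) (Φ : (Fin n → Option ℤˣ) → ℝ) (i : Fin n) :
    rE p Φ = p * rE p (fun ρ => Φ (Function.update ρ i none)) +
      (1 - p) / 2 * rE p (fun ρ => Φ (Function.update ρ i (some 1))) +
      (1 - p) / 2 * rE p (fun ρ => Φ (Function.update ρ i (some (-1)))) := by
  simp only [rE_split p _ i, update_funSplitAt, sum_rwt, mul_sum, ← sum_add_distrib]
  refine sum_congr rfl fun ρ _ => ?_
  ring

theorem rwt_nonneg {p : ℝ} (h0 : 0 ≤ p) (h1 : p ≤ 1) (c : Option ℤˣ) : 0 ≤ rwt p c := by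
  cases c <;> simp [rwt] <;> linarith

theorem rE_mono {n : ℕ} {p : ℝ} (h0 : 0 ≤ p) (h1 : p ≤ 1) {Φ Ψ : (Fin n → Option ℤˣ) → ℝ}
    (h : ∀ ρ, Φ ρ ≤ Ψ ρ) : rE p Φ ≤ rE p Ψ :=
  sum_le_sum fun ρ _ => mul_le_mul_of_nonneg_left (h ρ) (prod_nonneg fun _ _ => rwt_nonneg h0 h1 _)

theorem rE_add {n : ℕ} (p : ℝ) (Φ Ψ : (Fin n → Option ℤˣ) → ℝ) :
    rE p (fun ρ => Φ ρ + Ψ ρ) = rE p Φ + rE p Ψ := by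
  simp [rE, mul_add, sum_add_distrib]

theorem rE_mul {n : ℕ} (p c : ℝ) (Φ : (Fin n → Option ℤˣ) → ℝ) :
    rE p (fun ρ => c * Φ ρ) = c * rE p Φ := by
  simp only [rE, mul_sum]; exact sum_congr rfl fun _ _ => by ring

theorem rE_sum {n : ℕ} {κ : Type*} (p : ℝ) (s : Finset κ) (Φ : κ → (Fin n → Option ℤˣ) → ℝ) :
    rE p (fun ρ => ∑ a ∈ s, Φ a ρ) = ∑ a ∈ s, rE p (Φ a) := by
  simp only [rE, mul_sum]; exact sum_comm

theorem rE_one {n : ℕ} (p : ℝ) : rE p (fun _ : Fin n → Option ℤˣ => 1) = 1 := by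
  unfold rE
  have h := Finset.prod_univ_sum (fun _ : Fin n => (univ : Finset (Option ℤˣ)))
    (fun _ c => rwt p c)
  have h2 : ∑ c, rwt p c = 1 := by
    have := sum_rwt p (fun _ => 1)
    simp only [mul_one] at this
    rw [this]; ring
  simp only [mul_one]
  rw [Fintype.piFinset_univ] at h
  rw [← h]; simp [h2]

/-- Application of a restriction to the coordinates in `U`. -/
def restrOn {n : ℕ} (U : Finset (Fin n)) (ρ : Fin n → Option ℤˣ) (x : Cube n) : Cube n :=
  fun v => if v ∈ U then (ρ v).getD (x v) else x v

/-- Application of a restriction. -/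
def restr {n : ℕ} (ρ : Fin n → Option ℤˣ) (x : Cube n) : Cube n :=
  fun v => (ρ v).getD (x v)

/-- The inequality tensorizes: `hφ` is its one-coordinate case, since fixing a coordinate `i` to
`±1` turns the pair `ĝ(S)`, `ĝ(S ∪ {i})` into their sum or difference. -/
theorem wsum_le_rE {n : ℕ} (φ : ℝ → ℝ) (h0 : φ 0 = 0) {p : ℝ} (hp0 : 0 ≤ p) (hp1 : p ≤ 1)
    (d e : ℝ) (hd : 0 ≤ d) (he : 0 ≤ e) (hφ : ∀ a b, φ a + e * φ b ≤
      p * (φ a + d * φ b) + (1 - p) / 2 * (φ (a + b) + φ (a - b)))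
    (g : Cube n → ℝ) :
    wsum φ (fun _ => e) g ≤ rE p (fun ρ => wsum φ (fun _ => d) (fun x => g (restr ρ x))) := by
  -- Hybrid argument: coordinates in `U` have been traded for a random restriction. The weights off
  -- `U` must stay arbitrary, because the next coordinate has weight `e` when the induction
  -- hypothesis is applied.
  have key : ∀ U : Finset (Fin n), ∀ c : Fin n → ℝ, (∀ i, 0 ≤ c i) → (∀ i ∈ U, c i = d) →
      wsum φ (fun v => if v ∈ U then e else c v) g ≤
        rE p (fun ρ => wsum φ c (fun x => g (restrOn U ρ x))) := by
    intro U
    induction U using Finset.induction_on with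
    | empty =>
      intro c _ _
      have := rE_mul (n := n) p (wsum φ c g) (fun _ => 1)
      simp only [mul_one, rE_one] at this
      have hr : ∀ ρ x, restrOn (∅ : Finset (Fin n)) ρ x = x := fun ρ x => by
        funext v; simp [restrOn]
      simp only [hr, notMem_empty, if_false]
      exact this.ge
    | insert i U hi ih =>
      intro c hc hcd
      have hci : c i = d := hcd i (mem_insert_self _ _)
      have h1 := ih (Function.update c i e)
        (fun j => by by_cases h : j = i
                     · subst h; simpa using he
                     · simpa [Function.update_of_ne h] using hc j)
        (fun j hj => by
          rw [Function.update_of_ne (by rintro rfl; exact hi hj)]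
          exact hcd j (mem_insert_of_mem hj))
      have hL : (fun v => if v ∈ insert i U then e else c v) =
          (fun v => if v ∈ U then e else Function.update c i e v) := by
        funext v
        by_cases h : v = i
        · subst h; simp
        · simp [h]
      rw [hL]
      refine h1.trans ?_
      rw [rE_step p (fun ρ => wsum φ c (fun x => g (restrOn (insert i U) ρ x))) i,
        ← rE_mul, ← rE_mul, ← rE_mul, ← rE_add, ← rE_add]
      refine rE_mono hp0 hp1 fun ρ => ?_
      have hnone : (fun x => g (restrOn (insert i U) (Function.update ρ i none) x)) =
          (fun x => g (restrOn U ρ x)) := by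
        funext x; congr 1; funext v
        by_cases h : v = i
        · subst h; simp [restrOn, hi]
        · simp [restrOn, h]
      have hsome : ∀ b, (fun x => g (restrOn (insert i U) (Function.update ρ i (some b)) x)) =
          setc (fun x => g (restrOn U ρ x)) i b := by
        intro b
        funext x; unfold setc; congr 1; funext v
        by_cases h : v = i
        · subst h; simp [restrOn, hi]
        · simp [restrOn, h]
      rw [hnone, hsome, hsome, add_assoc, ← mul_add]
      exact wsum_step φ h0 p e c hc _ i (by rw [hci]; exact hφ)
  have h := key univ (fun _ => d) (fun _ => hd) (fun _ _ => rfl)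
  have hr : ∀ ρ x, restrOn (univ : Finset (Fin n)) ρ x = restr ρ x := fun ρ x => by
    funext v; simp [restrOn, restr]
  simpa only [hr, mem_univ, if_true] using h

/-! ### Orthogonality and Parseval -/

theorem sum_monomialOn_mul {n : ℕ} (x y : Cube n) :
    ∑ S, monomialOn S x * monomialOn S y = if x = y then 2 ^ n else 0 := by
  have h : ∑ S, monomialOn S x * monomialOn S y =
      ∏ i, (1 + (((x i : ℤˣ) : ℤ) : ℝ) * (((y i : ℤˣ) : ℤ) : ℝ)) := by
    rw [prod_one_add, ← powerset_univ]
    exact sum_congr rfl fun S _ => by simp [monomialOn, prod_mul_distrib]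
  rw [h]
  split_ifs with hxy
  · subst hxy
    have : ∀ i, (1 + (((x i : ℤˣ) : ℤ) : ℝ) * (((x i : ℤˣ) : ℤ) : ℝ)) = 2 := fun i => by
      rcases Int.units_eq_one_or (x i) with h | h <;> simp [h] <;> norm_num
    simp [this]
  · obtain ⟨i, hi⟩ := Function.ne_iff.1 hxy
    refine prod_eq_zero (mem_univ i) ?_
    rcases Int.units_eq_one_or (x i) with h | h <;> rcases Int.units_eq_one_or (y i) with h' | h' <;>
      simp_all

/-- The mean over the cube. -/
noncomputable def avg {n : ℕ} (g : Cube n → ℝ) : ℝ := (∑ x, g x) / 2 ^ n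

theorem parseval {n : ℕ} (g : Cube n → ℝ) :
    ∑ S, fourierCoef g S ^ 2 = avg (fun x => g x ^ 2) := by
  have h : ∀ S, fourierCoef g S ^ 2 =
      (∑ x, ∑ y, g x * g y * (monomialOn S x * monomialOn S y)) / (2 ^ n * 2 ^ n) := by
    intro S
    rw [fourierCoef, sq, div_mul_div_comm, sum_mul_sum]
    congr 1
    exact sum_congr rfl fun x _ => sum_congr rfl fun y _ => by ring
  simp only [h, avg]
  rw [← sum_div, sum_comm]
  have h2 : ∀ x : Cube n, ∑ S, ∑ y, g x * g y * (monomialOn S x * monomialOn S y) =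
      2 ^ n * g x ^ 2 := by
    intro x
    rw [sum_comm]
    simp only [← mul_sum, sum_monomialOn_mul]
    simp; ring
  simp only [h2, ← mul_sum]
  field_simp

/-! ### Terms and negated DNFs under assignments and restrictions -/

/-- Indicator of the term which asserts `x v = b v` for `v ∈ U`. -/
noncomputable def tind {n : ℕ} (U : Finset (Fin n)) (b x : Cube n) : ℝ :=
  if ∀ v ∈ U, x v = b v then 1 else 0

/-- The negation of the DNF with the terms `(V i, a i)`, `i ∈ I`. -/
noncomputable def negF {n : ℕ} {ι : Type*} (I : Finset ι) (V : ι → Finset (Fin n))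
    (a : ι → Cube n) (x : Cube n) : ℝ :=
  ∏ i ∈ I, (1 - tind (V i) (a i) x)

/-- Overwrite the coordinates in `U` by `b`. -/
def asg {n : ℕ} (U : Finset (Fin n)) (b x : Cube n) : Cube n :=
  fun v => if v ∈ U then b v else x v

/-- The terms which are not falsified by the assignment of `b` to `U`. -/
def compat {n : ℕ} {ι : Type*} (I : Finset ι) (V : ι → Finset (Fin n)) (a : ι → Cube n)
    (U : Finset (Fin n)) (b : Cube n) : Finset ι :=
  I.filter fun i => ∀ v ∈ V i ∩ U, a i v = b v

theorem tind_asg {n : ℕ} (W U : Finset (Fin n)) (c b x : Cube n) :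
    tind W c (asg U b x) = if ∀ v ∈ W ∩ U, c v = b v then tind (W \ U) c x else 0 := by
  unfold tind asg
  split_ifs with h1 h2 h3 h4 h5 <;> try rfl
  · refine absurd (fun v hv => ?_) h3
    have := h1 v (mem_sdiff.1 hv).1
    rwa [if_neg (mem_sdiff.1 hv).2] at this
  · refine absurd (fun v hv => ?_) h2
    have := h1 v (mem_inter.1 hv).1
    rw [if_pos (mem_inter.1 hv).2] at this
    exact this.symm
  · refine absurd (fun v hv => ?_) h1
    by_cases hU : v ∈ U
    · rw [if_pos hU]; exact (h4 v (mem_inter.2 ⟨hv, hU⟩)).symm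
    · rw [if_neg hU]; exact h5 v (mem_sdiff.2 ⟨hv, hU⟩)

theorem negF_asg {n : ℕ} {ι : Type*} (I : Finset ι) (V : ι → Finset (Fin n))
    (a : ι → Cube n) (U : Finset (Fin n)) (b x : Cube n) :
    negF I V a (asg U b x) = negF (compat I V a U b) (fun i => V i \ U) a x := by
  unfold negF compat
  rw [prod_filter]
  refine prod_congr rfl fun i _ => ?_
  rw [tind_asg]
  split_ifs <;> simp

/-- The restriction `ρ` falsifies the term `(W, c)`. -/
def Fals {n : ℕ} (W : Finset (Fin n)) (c : Cube n) (ρ : Fin n → Option ℤˣ) : Prop :=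
  ∃ v ∈ W, ρ v = some (-c v)

instance {n : ℕ} (W : Finset (Fin n)) (c : Cube n) (ρ : Fin n → Option ℤˣ) :
    Decidable (Fals W c ρ) := by unfold Fals; infer_instance

/-- Indicator that `ρ` falsifies all the terms in `K`. -/
noncomputable def allFals {n : ℕ} {ι : Type*} (K : Finset ι) (V : ι → Finset (Fin n))
    (a : ι → Cube n) (ρ : Fin n → Option ℤˣ) : ℝ :=
  if ∀ i ∈ K, Fals (V i) (a i) ρ then 1 else 0

theorem allFals_empty {n : ℕ} {ι : Type*} (V : ι → Finset (Fin n)) (a : ι → Cube n) :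
    allFals ∅ V a = fun _ => 1 := by
  funext ρ; simp [allFals]

theorem allFals_nonneg {n : ℕ} {ι : Type*} (K : Finset ι) (V : ι → Finset (Fin n))
    (a : ι → Cube n) (ρ : Fin n → Option ℤˣ) : 0 ≤ allFals K V a ρ := by
  unfold allFals; split_ifs <;> norm_num

theorem allFals_anti {n : ℕ} {ι : Type*} {K K' : Finset ι} (h : K ⊆ K')
    (V : ι → Finset (Fin n)) (a : ι → Cube n) (ρ : Fin n → Option ℤˣ) :
    allFals K' V a ρ ≤ allFals K V a ρ := by
  unfold allFals
  split_ifs with h1 h2 <;> try norm_num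
  exact h2 fun i hi => h1 i (h hi)

/-- The restriction which agrees with `b` on `U \ Y`, is free on `Y` and equals `ρ` off `U`. -/
def updR {n : ℕ} (U Y : Finset (Fin n)) (b : Cube n) (ρ : Fin n → Option ℤˣ) :
    Fin n → Option ℤˣ :=
  fun v => if v ∈ U then (if v ∈ Y then none else some (b v)) else ρ v

theorem fals_update {n : ℕ} {U : Finset (Fin n)} {i : Fin n} (hi : i ∉ U) (b : Cube n)
    (ρ : Fin n → Option ℤˣ) (c : Option ℤˣ) : Fals U b (Function.update ρ i c) ↔ Fals U b ρ := by
  unfold Fals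
  refine exists_congr fun v => and_congr_right fun hv => ?_
  rw [Function.update_of_ne (by rintro rfl; exact hi hv)]

theorem rE_step' {n : ℕ} (p : ℝ) (Φ : (Fin n → Option ℤˣ) → ℝ) (i : Fin n) (b : ℤˣ) :
    rE p Φ = p * rE p (fun ρ => Φ (Function.update ρ i none)) +
      (1 - p) / 2 * rE p (fun ρ => Φ (Function.update ρ i (some b))) +
      (1 - p) / 2 * rE p (fun ρ => Φ (Function.update ρ i (some (-b)))) := by
  rw [rE_step p Φ i]
  rcases Int.units_eq_one_or b with h | h <;> subst h
  · rfl
  · rw [neg_neg]; ring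

/-- When the term is not falsified, each of its variables is either free (probability `p`) or fixed
in agreement with `b` (probability `(1-p)/2`); `Y` is the set of the free ones. -/
theorem rE_unfals {n : ℕ} (p : ℝ) (b : Cube n) (U : Finset (Fin n)) :
    ∀ Φ : (Fin n → Option ℤˣ) → ℝ, rE p (fun ρ => if Fals U b ρ then 0 else Φ ρ) =
      ∑ Y ∈ U.powerset, p ^ #Y * ((1 - p) / 2) ^ (#U - #Y) *
        rE p (fun ρ => Φ (updR U Y b ρ)) := by
  induction U using Finset.induction_on with
  | empty =>
    intro Φ
    have h1 : ∀ ρ, ¬ Fals ∅ b ρ := fun ρ h => by obtain ⟨v, hv, _⟩ := h; simp at hv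
    have h2 : ∀ ρ, updR ∅ ∅ b ρ = ρ := fun ρ => by funext v; simp [updR]
    simp [h1, h2]
  | insert i U hi ih =>
    intro Φ
    rw [rE_step' p _ i (b i), sum_powerset_insert hi]
    have e1 : ∀ ρ c, c ≠ some (-b i) →
        (Fals (insert i U) b (Function.update ρ i c) ↔ Fals U b ρ) := by
      intro ρ c hc
      rw [← fals_update hi b ρ c]
      unfold Fals
      simp [hc]
    have e2 : ∀ ρ, Fals (insert i U) b (Function.update ρ i (some (-b i))) := fun ρ =>
      ⟨i, mem_insert_self _ _, by simp⟩
    have hb : some (b i) ≠ some (-b i) := by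
      rcases Int.units_eq_one_or (b i) with h | h <;> rw [h] <;> decide
    simp only [e1 _ none (by simp), e1 _ _ hb, e2, if_true]
    rw [ih (fun ρ => Φ (Function.update ρ i none)),
      ih (fun ρ => Φ (Function.update ρ i (some (b i))))]
    have hz : rE p (fun _ : Fin n → Option ℤˣ => (0 : ℝ)) = 0 := by simp [rE]
    rw [hz, mul_zero, add_zero, add_comm, mul_sum, mul_sum]
    congr 1
    · refine sum_congr rfl fun Y hY => ?_
      have hYU := mem_powerset.1 hY
      have hiY : i ∉ Y := fun h => hi (hYU h)
      have : ∀ ρ, Function.update (updR U Y b ρ) i (some (b i)) = updR (insert i U) Y b ρ := by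
        intro ρ; funext v
        by_cases h : v = i
        · subst h; simp [updR, hiY]
        · simp [updR, h]
      simp only [this, card_insert_of_notMem hi]
      rw [Nat.succ_sub (card_le_card hYU), pow_succ]; ring
    · refine sum_congr rfl fun Y hY => ?_
      have hYU := mem_powerset.1 hY
      have hiY : i ∉ Y := fun h => hi (hYU h)
      have : ∀ ρ, Function.update (updR U Y b ρ) i none = updR (insert i U) (insert i Y) b ρ := by
        intro ρ; funext v
        by_cases h : v = i
        · subst h; simp [updR]
        · simp [updR, h]
      simp only [this, card_insert_of_notMem hi, card_insert_of_notMem hiY]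
      rw [Nat.add_sub_add_right, pow_succ]; ring

/-- The assignment `b` with the signs flipped on `Z`. -/
def flipOn {n : ℕ} (Z : Finset (Fin n)) (b : Cube n) : Cube n :=
  fun v => if v ∈ Z then -b v else b v

/-- This queries all variables in `Y`, as a decision tree would. The branches are indexed by the set
`Z` where the answer disagrees with `b`, so that `Z = ∅` is the branch satisfying the free part of
the term. -/
theorem le_sum_flipOn {n : ℕ} (N : (Cube n → ℝ) → ℝ)
    (hN : ∀ g i, N g ≤ N (setc g i 1) + N (setc g i (-1))) (b : Cube n) (Y : Finset (Fin n)) :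
    ∀ g, N g ≤ ∑ Z ∈ Y.powerset, N (fun x => g (asg Y (flipOn Z b) x)) := by
  induction Y using Finset.induction_on with
  | empty =>
    intro g
    have : ∀ x, asg ∅ (flipOn ∅ b) x = x := fun x => by funext v; simp [asg]
    simp [this]
  | insert i Y hi ih =>
    intro g
    rw [sum_powerset_insert hi]
    have h1 : N g ≤ N (setc g i (b i)) + N (setc g i (-b i)) := by
      have := hN g i
      rcases Int.units_eq_one_or (b i) with h | h <;> rw [h]
      · exact this
      · rw [neg_neg]; linarith
    refine h1.trans (add_le_add ((ih _).trans (sum_le_sum fun Z hZ => le_of_eq ?_))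
      ((ih _).trans (sum_le_sum fun Z hZ => le_of_eq ?_)))
    · have hiZ : i ∉ Z := fun h => hi (mem_powerset.1 hZ h)
      congr 1; funext x; unfold setc; congr 1; funext v
      by_cases h : v = i
      · subst h; simp [asg, flipOn, hiZ]
      · simp [asg, h]
    · congr 1; funext x; unfold setc; congr 1; funext v
      by_cases h : v = i
      · subst h; simp [asg, flipOn]
      · simp [asg, h, flipOn]

theorem asg_restr {n : ℕ} {U Y Z : Finset (Fin n)} (hY : Y ⊆ U) (hZ : Z ⊆ Y) (b : Cube n)
    (ρ : Fin n → Option ℤˣ) (x : Cube n) :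
    restr (updR U Y b ρ) (asg Y (flipOn Z b) x) = asg U (flipOn Z b) (restr ρ x) := by
  funext v
  by_cases hU : v ∈ U
  · by_cases hv : v ∈ Y
    · simp [restr, updR, asg, hU, hv]
    · have : v ∉ Z := fun h => hv (hZ h)
      simp [restr, updR, asg, hU, hv, flipOn, this]
  · have : v ∉ Y := fun h => hU (hY h)
    simp [restr, updR, asg, hU, this]

/-- Once the restriction is known on `U`, the conditioning keeps its shape: terms already falsified
on `U \ Y` drop out, the others must be falsified off `U`. This closes the induction in `switching`.
-/
theorem allFals_updR {n : ℕ} {ι : Type*} (K : Finset ι) (V : ι → Finset (Fin n))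
    (a : ι → Cube n) (U Y : Finset (Fin n)) (b : Cube n) (ρ : Fin n → Option ℤˣ) :
    allFals K V a (updR U Y b ρ) =
      allFals (compat K V a (U \ Y) b) (fun i => V i \ U) a ρ := by
  have key : ∀ i, Fals (V i) (a i) (updR U Y b ρ) ↔
      ((∀ v ∈ V i ∩ (U \ Y), a i v = b v) → Fals (V i \ U) (a i) ρ) := by
    intro i
    constructor
    · rintro ⟨v, hv, h⟩ hc
      by_cases hU : v ∈ U
      · by_cases hY : v ∈ Y
        · simp [updR, hU, hY] at h
        · have := hc v (by simp [hv, hU, hY])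
          rw [updR, if_pos hU, if_neg hY, ← this] at h
          rcases Int.units_eq_one_or (a i v) with h' | h' <;> rw [h'] at h <;>
            exact absurd h (by decide)
      · exact ⟨v, by simp [hv, hU], by simpa [updR, hU] using h⟩
    · intro h
      by_cases hc : ∀ v ∈ V i ∩ (U \ Y), a i v = b v
      · obtain ⟨v, hv, h⟩ := h hc
        rw [mem_sdiff] at hv
        exact ⟨v, hv.1, by simpa [updR, hv.2] using h⟩
      · push Not at hc
        obtain ⟨v, hv, hne⟩ := hc
        simp only [mem_inter, mem_sdiff] at hv
        refine ⟨v, hv.1, ?_⟩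
        rw [updR, if_pos hv.2.1, if_neg hv.2.2]
        congr 1
        rcases Int.units_eq_one_or (a i v) with h1 | h1 <;>
          rcases Int.units_eq_one_or (b v) with h2 | h2 <;> simp_all
  unfold allFals compat
  simp only [key, mem_filter, and_imp]

/-! ### The switching lemma -/

/-- A switching lemma: the mean of a subadditive functional of a randomly restricted DNF of
width `r` is at most `2`, conditionally on any set of terms being falsified. -/
theorem switching {n : ℕ} {ι : Type*} [DecidableEq ι] (N : (Cube n → ℝ) → ℝ)
    (hN : ∀ g i, N g ≤ N (setc g i 1) + N (setc g i (-1))) (hN0 : N (fun _ => 0) ≤ 1)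
    (hN1 : N (fun _ => 1) ≤ 1) {p : ℝ} (hp0 : 0 ≤ p) (hp1 : p ≤ 1) (r : ℕ)
    (hpr : ∀ u ≤ r, 2 * (2 * p + (1 - p) / 2) ^ u ≤ 3 * ((1 - p) / 2) ^ u)
    (a : ι → Cube n) (m : ℕ) : ∀ (I K : Finset ι) (V : ι → Finset (Fin n)), #I ≤ m →
      (∀ i ∈ I, #(V i) ≤ r) →
      rE p (fun ρ => N (fun x => negF I V a (restr ρ x)) * allFals K V a ρ) ≤
        2 * rE p (allFals K V a) := by
  induction m with
  | zero =>
    intro I K V hI _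
    have : I = ∅ := card_eq_zero.1 (Nat.le_zero.1 hI)
    subst this
    rw [← rE_mul]
    refine rE_mono hp0 hp1 fun ρ => mul_le_mul_of_nonneg_right ?_ (allFals_nonneg _ _ _ _)
    simp only [negF, prod_empty]; linarith
  | succ m ih =>
    intro I K V hI hr
    rcases I.eq_empty_or_nonempty with rfl | ⟨i, hi⟩
    · exact ih ∅ K V (by simp) hr
    obtain ⟨J, hiJ, rfl⟩ : ∃ J, i ∉ J ∧ insert i J = I :=
      ⟨I.erase i, notMem_erase i I, insert_erase hi⟩
    have hJ : #J ≤ m := by rw [card_insert_of_notMem hiJ] at hI; omega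
    have hrJ : ∀ j ∈ J, #(V j) ≤ r := fun j hj => hr j (mem_insert_of_mem hj)
    set U := V i with hU
    set b := a i with hb
    have hq : 0 ≤ (1 - p) / 2 := by linarith
    -- the falsified part
    have hA : rE p (fun ρ => N (fun x => negF (insert i J) V a (restr ρ x)) *
          allFals (insert i K) V a ρ) ≤ 2 * rE p (allFals (insert i K) V a) := by
      refine le_trans (le_of_eq ?_) (ih J (insert i K) V hJ hrJ)
      congr 1; funext ρ
      by_cases h : ∀ j ∈ insert i K, Fals (V j) (a j) ρ
      · congr 2; funext x
        obtain ⟨v, hv, hvρ⟩ := h i (mem_insert_self _ _)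
        have : tind (V i) (a i) (restr ρ x) = 0 := by
          unfold tind
          rw [if_neg]
          intro hall
          have := hall v hv
          rw [restr, hvρ, Option.getD_some] at this
          rcases Int.units_eq_one_or (a i v) with h' | h' <;> rw [h'] at this <;>
            exact absurd this (by decide)
        rw [negF, prod_insert hiJ, this, sub_zero, one_mul]; rfl
      · rw [allFals, if_neg h, mul_zero, mul_zero]
    -- the other part
    set κ : Finset (Fin n) → ℝ := fun Y => rE p (fun ρ => allFals K V a (updR U Y b ρ)) with hκ
    have hκ0 : ∀ Y, 0 ≤ κ Y := fun Y => by
      have := rE_mono (n := n) hp0 hp1 (Φ := fun _ => 0)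
        (Ψ := fun ρ => allFals K V a (updR U Y b ρ)) (fun ρ => allFals_nonneg _ _ _ _)
      rwa [show rE p (fun _ : Fin n → Option ℤˣ => (0 : ℝ)) = 0 by simp [rE]] at this
    -- Freeing variables only makes it harder to falsify the terms in `K`; thus the conditioning
    -- cannot favour restrictions with many free variables.
    have hκle : ∀ Y, κ Y ≤ κ ∅ := fun Y => by
      refine rE_mono hp0 hp1 fun ρ => ?_
      simp only [allFals_updR]
      refine allFals_anti (fun j hj => ?_) _ _ _
      simp only [compat, mem_filter, mem_inter, mem_sdiff] at hj ⊢
      exact ⟨hj.1, fun v hv => hj.2 v ⟨hv.1, hv.2.1, by simp⟩⟩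
    -- Of the `2 ^ #Y` branches, the one satisfying term `i` makes the function zero and costs at
    -- most 1; each other one falsifies term `i` and costs at most 2 by induction.
    have hB1 : ∀ Y ∈ U.powerset, rE p (fun ρ =>
        N (fun x => negF (insert i J) V a (restr (updR U Y b ρ) x)) *
          allFals K V a (updR U Y b ρ)) ≤ (2 * 2 ^ #Y - 1) * κ Y := by
      intro Y hY
      have hYU := mem_powerset.1 hY
      have h1 : ∀ ρ, N (fun x => negF (insert i J) V a (restr (updR U Y b ρ) x)) *
          allFals K V a (updR U Y b ρ) ≤ ∑ Z ∈ Y.powerset,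
            N (fun x => negF (compat (insert i J) V a U (flipOn Z b)) (fun j => V j \ U) a
              (restr ρ x)) *
            allFals (compat K V a (U \ Y) b) (fun j => V j \ U) a ρ := by
        intro ρ
        rw [← sum_mul, allFals_updR]
        refine mul_le_mul_of_nonneg_right ?_ (allFals_nonneg _ _ _ _)
        refine (le_sum_flipOn N hN b Y _).trans (sum_le_sum fun Z hZ => le_of_eq ?_)
        congr 1; funext x
        rw [asg_restr hYU (mem_powerset.1 hZ), negF_asg]
      refine (rE_mono hp0 hp1 h1).trans ?_
      rw [rE_sum]
      have h2 : ∀ Z ∈ Y.powerset, rE p (fun ρ =>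
          N (fun x => negF (compat (insert i J) V a U (flipOn Z b)) (fun j => V j \ U) a
              (restr ρ x)) *
            allFals (compat K V a (U \ Y) b) (fun j => V j \ U) a ρ) ≤
          (if Z = ∅ then 1 else 2) * κ Y := by
        intro Z hZ
        have hZY := mem_powerset.1 hZ
        have hκ' : κ Y = rE p (allFals (compat K V a (U \ Y) b) (fun j => V j \ U) a) := by
          simp only [hκ, allFals_updR]
        rw [hκ']
        split_ifs with h
        · subst h
          rw [one_mul]
          refine rE_mono hp0 hp1 fun ρ => mul_le_of_le_one_left (allFals_nonneg _ _ _ _) ?_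
          refine le_trans (le_of_eq ?_) hN0
          congr 1; funext x
          rw [← negF_asg, negF, prod_insert hiJ]
          have : tind (V i) (a i) (asg U (flipOn ∅ b) (restr ρ x)) = 1 := by
            rw [tind, if_pos]
            intro v hv
            simp [asg, flipOn, hU, hv, hb]
          rw [this]; ring
        · have hc : compat (insert i J) V a U (flipOn Z b) = compat J V a U (flipOn Z b) := by
            unfold compat
            rw [filter_insert, if_neg]
            intro hall
            obtain ⟨v, hv⟩ := nonempty_iff_ne_empty.2 h
            have hvU := hYU (hZY hv)
            have := hall v (by simp [← hU, hvU])
            rw [flipOn, if_pos hv, hb] at this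
            rcases Int.units_eq_one_or (a i v) with h' | h' <;> rw [h'] at this <;>
              exact absurd this (by decide)
          rw [hc]
          refine ih _ _ _ ((card_filter_le _ _).trans hJ) fun j hj => ?_
          exact (card_le_card sdiff_subset).trans (hrJ j (mem_filter.1 hj).1)
      refine (sum_le_sum h2).trans (le_of_eq ?_)
      rw [← sum_mul]
      congr 1
      have h3 : ∀ Z ∈ Y.powerset, (if Z = ∅ then (1 : ℝ) else 2) =
          2 - (if Z = ∅ then 1 else 0) := fun Z _ => by split_ifs <;> norm_num
      rw [sum_congr rfl h3, sum_sub_distrib, sum_ite_eq']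
      simp [card_powerset]; ring
    have hsplit : ∀ Φ : (Fin n → Option ℤˣ) → ℝ, rE p (fun ρ => Φ ρ * allFals K V a ρ) =
        rE p (fun ρ => Φ ρ * allFals (insert i K) V a ρ) +
          rE p (fun ρ => if Fals U b ρ then 0 else Φ ρ * allFals K V a ρ) := by
      intro Φ
      rw [← rE_add]
      congr 1; funext ρ
      simp only [allFals, forall_mem_insert, ← hU, ← hb]
      by_cases h : Fals U b ρ <;> simp [h]
    have hone := hsplit (fun _ => 1)
    simp only [one_mul] at hone
    rw [hsplit, hone, mul_add]
    refine add_le_add hA ?_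
    rw [rE_unfals, rE_unfals]
    change _ ≤ 2 * ∑ Y ∈ U.powerset, _ * κ Y
    -- The excess over the target `2 κ Y` is compared with `κ ∅`. For `Y = ∅` the factor is `1 = 2 +
    -- (2 - 3)`; this saving must pay for all other `Y`. Summed by the binomial theorem, the excess
    -- is `2 (2p + (1-p)/2)^#U - 3 ((1-p)/2)^#U`, which `hpr` makes nonpositive.
    have hterm : ∀ Y ∈ U.powerset, p ^ #Y * ((1 - p) / 2) ^ (#U - #Y) *
        rE p (fun ρ => N (fun x => negF (insert i J) V a (restr (updR U Y b ρ) x)) *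
          allFals K V a (updR U Y b ρ)) ≤
        2 * (p ^ #Y * ((1 - p) / 2) ^ (#U - #Y) * κ Y) +
        (2 * ((2 * p) ^ #Y * ((1 - p) / 2) ^ (#U - #Y)) -
          (if Y = ∅ then 3 * ((1 - p) / 2) ^ #U else 0)) * κ ∅ := by
      intro Y hY
      have hc : 0 ≤ p ^ #Y * ((1 - p) / 2) ^ (#U - #Y) := by positivity
      refine (mul_le_mul_of_nonneg_left (hB1 Y hY) hc).trans ?_
      split_ifs with h
      · subst h; simp; apply le_of_eq; ring
      · have h1 := mul_le_mul_of_nonneg_left (hκle Y) hc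
        have h2 := mul_nonneg hc (hκ0 Y)
        have h3 := mul_le_mul_of_nonneg_left h1 (show (0 : ℝ) ≤ 2 * 2 ^ #Y by positivity)
        rw [mul_pow]
        nlinarith
    refine (sum_le_sum hterm).trans ?_
    rw [sum_add_distrib, ← mul_sum, ← sum_mul, sum_sub_distrib, ← mul_sum,
      sum_pow_mul_eq_add_pow, sum_ite_eq', if_pos (by simp)]
    have := hpr #U (hr i (mem_insert_self _ _))
    have := mul_nonneg (sub_nonneg.2 this) (hκ0 ∅)
    linarith

/-- With `q = (1-p)/2 ≥ 2/5` one has `(2p + q)/q ≤ exp (5p)`, and `exp (5 p u) ≤ exp (5/16) ≤ 3/2`.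
-/
theorem switching_param {r : ℕ} (hr : 0 < r) : ∀ u ≤ r,
    2 * (2 * (1 / (16 * r : ℝ)) + (1 - 1 / (16 * r : ℝ)) / 2) ^ u ≤
      3 * ((1 - 1 / (16 * r : ℝ)) / 2) ^ u := by
  intro u hu
  have hr1 : (1 : ℝ) ≤ r := by exact_mod_cast hr
  set p : ℝ := 1 / (16 * r) with hp
  have hp0 : 0 < p := by positivity
  have hpr : p * r = 1 / 16 := by rw [hp]; field_simp
  have hp1 : p ≤ 1 / 16 := by nlinarith
  have hq : 0 < (1 - p) / 2 := by linarith
  have h1 : 2 * p + (1 - p) / 2 ≤ Real.exp (5 * p) * ((1 - p) / 2) := by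
    have := Real.add_one_le_exp (5 * p)
    nlinarith
  have h2 : (2 * p + (1 - p) / 2) ^ u ≤ Real.exp (5 * p) ^ u * ((1 - p) / 2) ^ u := by
    rw [← mul_pow]; exact pow_le_pow_left₀ (by positivity) h1 u
  have h3 : Real.exp (5 * p) ^ u ≤ 3 / 2 := by
    rw [← Real.exp_nat_mul]
    have hu' : (u : ℝ) ≤ r := by exact_mod_cast hu
    have h4 : (u : ℝ) * (5 * p) ≤ 5 / 16 := by nlinarith
    have h5 := Real.exp_bound_div_one_sub_of_interval (x := 5 / 16) (by norm_num) (by norm_num)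
    calc Real.exp (u * (5 * p)) ≤ Real.exp (5 / 16) := Real.exp_le_exp.2 h4
      _ ≤ 3 / 2 := by norm_num at h5; linarith
  have h6 : 0 < ((1 - p) / 2) ^ u := by positivity
  nlinarith

/-! ### Consequences of switching: damped norm and Fourier tail for bounded width -/

/-- The sum of the moduli of the Fourier coefficients, damped by `p ^ |S|`. -/
noncomputable def pnorm {n : ℕ} (p : ℝ) (g : Cube n → ℝ) : ℝ :=
  wsum (fun t => |t|) (fun _ => p) g

theorem wsum_const_le_one {n : ℕ} (φ : ℝ → ℝ) (h0 : φ 0 = 0) (c : Fin n → ℝ) (t : ℝ)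
    (ht : φ t ≤ 1) : wsum φ c (fun _ => t) ≤ 1 := by
  have h : ∀ S : Finset (Fin n), S ≠ ∅ → fourierCoef (fun _ => t) S = 0 := by
    intro S hS
    obtain ⟨i, hi⟩ := nonempty_iff_ne_empty.2 hS
    have := fourierCoef_insert_eq_setc (fun _ : Cube n => t) (notMem_erase i S)
    rw [insert_erase hi] at this
    rw [this]; unfold setc; simp
  have h' : fourierCoef (fun _ : Cube n => t) ∅ = t := by
    simp [fourierCoef, monomialOn]
  unfold wsum
  rw [sum_eq_single ∅ (fun S _ hS => by rw [h S hS, h0, mul_zero]) (by simp)]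
  simpa [h'] using ht

/-- Damping by `p` is dominated by averaging the undamped norm over `p`-random restrictions, since
`2 |a| ≤ |a + b| + |a - b|`; `switching` bounds that average. -/
theorem pnorm_negF_le {n : ℕ} {ι : Type*} [DecidableEq ι] {r : ℕ} (hr : 0 < r) (I : Finset ι)
    (V : ι → Finset (Fin n)) (a : ι → Cube n) (hV : ∀ i ∈ I, #(V i) ≤ r) :
    pnorm (1 / (16 * r)) (negF I V a) ≤ 2 := by
  have hr1 : (1 : ℝ) ≤ r := by exact_mod_cast hr
  have hp0 : (0 : ℝ) ≤ 1 / (16 * r) := by positivity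
  have hp1 : (1 / (16 * r) : ℝ) ≤ 1 := by rw [div_le_one (by positivity)]; linarith
  have h1 := wsum_le_rE (fun t => |t|) abs_zero hp0 hp1 1 _ zero_le_one hp0
    (fun a b => by
      have : |a + b| + |a - b| ≥ 2 * |a| := by
        have := abs_add_le (a + b) (a - b)
        rw [show a + b + (a - b) = 2 * a by ring, abs_mul, abs_two] at this
        linarith
      nlinarith) (negF I V a)
  refine h1.trans ?_
  have h2 := switching (ι := ι) (wsum (n := n) (fun t => |t|) (fun _ => 1))
    (fun g i => wsum_le_setc _ abs_zero _ (fun _ => zero_le_one) g i fun a b => by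
      have h1 := abs_add_le (a + b) (a - b)
      have h2 := abs_sub (a + b) (a - b)
      rw [show a + b + (a - b) = 2 * a by ring, abs_mul, abs_two] at h1
      rw [show a + b - (a - b) = 2 * b by ring, abs_mul, abs_two] at h2
      linarith)
    (wsum_const_le_one _ abs_zero _ _ (by norm_num))
    (wsum_const_le_one _ abs_zero _ _ (by norm_num)) hp0 hp1 r (switching_param hr) a #I I ∅ V
    le_rfl hV
  simpa only [allFals_empty, rE_one, mul_one] using h2

/-- For squares the one-coordinate relation is an identity: weight 2 on the restricted function
averages to weight `1 + p` on the original. Weight 2 is the largest for which `a² + c b² ≤ (a+b)² +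
(a-b)²` always holds. -/
theorem sum_sq_negF_le {n : ℕ} {ι : Type*} [DecidableEq ι] {r : ℕ} (hr : 0 < r) (I : Finset ι)
    (V : ι → Finset (Fin n)) (a : ι → Cube n) (hV : ∀ i ∈ I, #(V i) ≤ r) :
    ∑ S, (1 + 1 / (16 * r : ℝ)) ^ #S * fourierCoef (negF I V a) S ^ 2 ≤ 2 := by
  have hr1 : (1 : ℝ) ≤ r := by exact_mod_cast hr
  have hp0 : (0 : ℝ) ≤ 1 / (16 * r) := by positivity
  have hp1 : (1 / (16 * r) : ℝ) ≤ 1 := by rw [div_le_one (by positivity)]; linarith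
  have h0 : (fun t : ℝ => t ^ 2) 0 = 0 := by norm_num
  have h1 := wsum_le_rE (fun t => t ^ 2) h0 hp0 hp1 2 (1 + 1 / (16 * r)) zero_le_two
    (by positivity) (fun a b => le_of_eq (by ring)) (negF I V a)
  simp only [wsum, prod_const] at h1
  refine h1.trans ?_
  have h2 := switching (ι := ι) (wsum (n := n) (fun t => t ^ 2) (fun _ => 2))
    (fun g i => wsum_le_setc (fun t => t ^ 2) h0 _ (fun _ => zero_le_two) g i fun a b => by
      nlinarith [sq_nonneg a])
    (wsum_const_le_one (fun t => t ^ 2) h0 _ 0 (by norm_num))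
    (wsum_const_le_one (fun t => t ^ 2) h0 _ 1 (by norm_num)) hp0 hp1 r (switching_param hr) a #I I ∅ V
    le_rfl hV
  simpa only [allFals_empty, rE_one, mul_one, wsum, prod_const] using h2

/-! ### Damped norm of products with a term and of read-`k` formulas -/

theorem fourierCoef_sub {n : ℕ} (f g : Cube n → ℝ) (S : Finset (Fin n)) :
    fourierCoef (fun x => f x - g x) S = fourierCoef f S - fourierCoef g S := by
  simp only [fourierCoef, sub_mul, sum_sub_distrib, sub_div]

theorem fourierCoef_sum {n : ℕ} {κ : Type*} (s : Finset κ) (c : κ → ℝ) (f : κ → Cube n → ℝ)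
    (S : Finset (Fin n)) :
    fourierCoef (fun x => ∑ i ∈ s, c i * f i x) S = ∑ i ∈ s, c i * fourierCoef (f i) S := by
  simp only [fourierCoef, sum_mul, mul_div_assoc', mul_sum, ← sum_div]
  rw [sum_comm]
  simp only [mul_assoc]

theorem pnorm_sub_le {n : ℕ} {p : ℝ} (hp : 0 ≤ p) (f g : Cube n → ℝ) :
    pnorm p (fun x => f x - g x) ≤ pnorm p f + pnorm p g := by
  unfold pnorm wsum
  rw [← sum_add_distrib]
  refine sum_le_sum fun S _ => ?_
  rw [fourierCoef_sub, ← mul_add]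
  exact mul_le_mul_of_nonneg_left (abs_sub _ _) (prod_nonneg fun _ _ => hp)

theorem pnorm_sum_le {n : ℕ} {κ : Type*} {p : ℝ} (hp : 0 ≤ p) (s : Finset κ) (c : κ → ℝ)
    (f : κ → Cube n → ℝ) :
    pnorm p (fun x => ∑ i ∈ s, c i * f i x) ≤ ∑ i ∈ s, |c i| * pnorm p (f i) := by
  unfold pnorm wsum
  simp only [fourierCoef_sum, mul_sum]
  rw [sum_comm]
  refine sum_le_sum fun S _ => ?_
  have h : ∀ i ∈ s, |c i| * ((∏ _j ∈ S, p) * |fourierCoef (f i) S|) =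
      (∏ _j ∈ S, p) * |c i * fourierCoef (f i) S| := fun i _ => by rw [abs_mul]; ring
  rw [sum_congr rfl h, ← mul_sum]
  exact mul_le_mul_of_nonneg_left (abs_sum_le_sum_abs _ _) (prod_nonneg fun _ _ => hp)

/-- One half of the cube contributes nothing, so the coefficients at `S` and at `insert i S` are
both, up to sign, half of the restricted coefficient at `S`; the second is damped by an extra `p`.
-/
theorem pnorm_literal_mul_le {n : ℕ} (p : ℝ) (ψ : Cube n → ℝ) (i : Fin n)
    (c : ℤˣ) : pnorm p (fun x => if x i = c then ψ x else 0) =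
      (1 + p) / 2 * pnorm p (setc ψ i c) := by
  set G : Cube n → ℝ := fun x => if x i = c then ψ x else 0 with hG
  have h1 : setc G i c = setc ψ i c := by funext x; simp [setc, hG]
  have h2 : setc G i (-c) = fun _ => 0 := by
    funext x
    have : -c ≠ c := by rcases Int.units_eq_one_or c with h | h <;> rw [h] <;> decide
    simp [setc, hG, this]
  have h0 : ∀ S, fourierCoef (fun _ : Cube n => (0 : ℝ)) S = 0 := fun S => by simp [fourierCoef]
  unfold pnorm
  rw [wsum_split _ _ _ i, wsum_setc _ abs_zero, mul_sum]
  refine sum_congr rfl fun S hS => ?_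
  have hi : i ∉ S := fun h => by simpa using (mem_powerset.1 hS) h
  rw [fourierCoef_eq_setc G hi, fourierCoef_insert_eq_setc G hi]
  rcases Int.units_eq_one_or c with h | h
  · subst h
    rw [h1, h2, h0]; simp only [add_zero, sub_zero, abs_div, abs_two]; ring
  · subst h
    rw [neg_neg] at h2
    rw [h1, h2, h0]; simp only [zero_add, zero_sub, abs_div, abs_neg, abs_two]; ring

theorem tind_insert {n : ℕ} (U : Finset (Fin n)) (i : Fin n) (b x : Cube n) :
    tind (insert i U) b x = if x i = b i then tind U b x else 0 := by
  unfold tind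
  simp only [forall_mem_insert]
  split_ifs <;> simp_all

theorem tind_update {n : ℕ} {U : Finset (Fin n)} {i : Fin n} (hi : i ∉ U) (b x : Cube n)
    (c : ℤˣ) : tind U b (Function.update x i c) = tind U b x := by
  unfold tind
  congr 1
  refine propext (forall₂_congr fun v hv => ?_)
  rw [Function.update_of_ne (by rintro rfl; exact hi hv)]

theorem pnorm_tind_mul {n : ℕ} (p : ℝ) (b : Cube n) (U : Finset (Fin n)) :
    ∀ φ : Cube n → ℝ, pnorm p (fun x => tind U b x * φ x) =
      ((1 + p) / 2) ^ #U * pnorm p (fun x => φ (asg U b x)) := by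
  induction U using Finset.induction_on with
  | empty =>
    intro φ
    have : ∀ x, asg ∅ b x = x := fun x => by funext v; simp [asg]
    simp [tind, this]
  | insert i U hi ih =>
    intro φ
    have h1 : (fun x => tind (insert i U) b x * φ x) =
        fun x => if x i = b i then tind U b x * φ x else 0 := by
      funext x; rw [tind_insert]; split_ifs <;> simp
    have h2 : setc (fun x => tind U b x * φ x) i (b i) =
        fun x => tind U b x * setc φ i (b i) x := by
      funext x; simp [setc, tind_update hi]
    have h3 : ∀ x, setc φ i (b i) (asg U b x) = φ (asg (insert i U) b x) := by
      intro x; unfold setc; congr 1; funext v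
      by_cases h : v = i
      · subst h; simp [asg]
      · simp [asg, h]
    rw [h1, pnorm_literal_mul_le, h2, ih, card_insert_of_notMem hi, pow_succ]
    simp only [h3]; ring

theorem card_adjacent_le {n : ℕ} {ι : Type*} [DecidableEq ι] (J : Finset ι)
    (V : ι → Finset (Fin n)) (U : Finset (Fin n)) (k : ℕ)
    (hk : ∀ v, #(J.filter fun j => v ∈ V j) ≤ k) :
    #(J.filter fun j => ¬ Disjoint (V j) U) ≤ #U * k := by
  refine le_trans (card_le_card fun j hj => ?_)
    (card_biUnion_le_card_mul U (fun v => J.filter fun j => v ∈ V j) k fun v _ => hk v)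
  rw [mem_filter, not_disjoint_iff] at hj
  obtain ⟨hj, v, hv, hvU⟩ := hj
  exact mem_biUnion.2 ⟨v, hvU, mem_filter.2 ⟨hj, hv⟩⟩

/-- The damped Fourier norm of the negation of a read-`k` DNF, in terms of the widths of those of
its terms which are not known to be narrow. -/
theorem pnorm_negF_chain {n : ℕ} {ι : Type*} [DecidableEq ι] {r : ℕ} (hr : 0 < r) (k : ℕ)
    {γ : ℝ} (hγ0 : 0 ≤ γ) (hγ1 : γ ≤ 1)
    (hγ : (1 + 1 / (16 * r : ℝ)) / 2 * Real.exp (k * γ ^ r) ≤ γ) (a : ι → Cube n) (m : ℕ) :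
    ∀ (I M : Finset ι) (V : ι → Finset (Fin n)), #I ≤ m → (∀ i ∈ M, #(V i) ≤ r) →
      (∀ v, #(I.filter fun i => v ∈ V i) ≤ k) →
      pnorm (1 / (16 * r)) (negF (I ∪ M) V a) ≤ 2 * Real.exp (∑ i ∈ I, γ ^ #(V i)) := by
  induction m with
  | zero =>
    intro I M V hI hM _
    have : I = ∅ := card_eq_zero.1 (Nat.le_zero.1 hI)
    subst this
    simpa using pnorm_negF_le hr M V a hM
  | succ m ih =>
    intro I M V hI hM hk
    rcases I.eq_empty_or_nonempty with rfl | ⟨i, hi⟩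
    · simpa using pnorm_negF_le hr M V a hM
    obtain ⟨J, hiJ, rfl⟩ : ∃ J, i ∉ J ∧ insert i J = I :=
      ⟨I.erase i, notMem_erase i I, insert_erase hi⟩
    have hJ : #J ≤ m := by rw [card_insert_of_notMem hiJ] at hI; omega
    have hkJ : ∀ v, #(J.filter fun i => v ∈ V i) ≤ k := fun v =>
      (card_le_card (filter_subset_filter _ (subset_insert i J))).trans (hk v)
    have hIH := ih J M V hJ hM hkJ
    have hγu : 0 ≤ γ ^ #(V i) := by positivity
    rw [sum_insert hiJ, Real.exp_add]
    set E := Real.exp (∑ j ∈ J, γ ^ #(V j)) with hE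
    have hE0 : 0 < E := Real.exp_pos _
    have hexp := Real.add_one_le_exp (γ ^ #(V i))
    rw [insert_union]
    by_cases hmem : i ∈ J ∪ M
    · rw [insert_eq_of_mem hmem]
      refine hIH.trans ?_
      nlinarith [mul_nonneg hE0.le hγu]
    have hsub : negF (insert i (J ∪ M)) V a =
        fun x => negF (J ∪ M) V a x - tind (V i) (a i) x * negF (J ∪ M) V a x := by
      funext x; unfold negF; rw [prod_insert hmem]; ring
    have hp0 : (0 : ℝ) ≤ 1 / (16 * r) := by positivity
    rw [hsub]
    refine (pnorm_sub_le hp0 _ _).trans ?_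
    rw [pnorm_tind_mul]
    simp only [negF_asg]
    set U := V i with hU
    -- Terms disjoint from `U` are unchanged. Of those meeting `U`, the ones still wider than `r`
    -- stay in the sum at a price of at most `γ ^ r` each; the ones shrunk to width `r` join the
    -- narrow family free of charge.
    set J' := (compat J V a U (a i)).filter fun j => Disjoint (V j) U ∨ r < #(V j \ U) with hJ'
    set M' := compat M V a U (a i) ∪
      (compat J V a U (a i)).filter fun j => ¬ (Disjoint (V j) U ∨ r < #(V j \ U)) with hM'
    have hset : compat (J ∪ M) V a U (a i) = J' ∪ M' := by
      rw [hJ', hM', union_comm (compat M V a U (a i)), ← union_assoc, filter_union_filter_not_eq]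
      unfold compat; rw [filter_union]
    have hJ'J : J' ⊆ J := (filter_subset _ _).trans (filter_subset _ _)
    have h2 := ih J' M' (fun j => V j \ U) ((card_le_card hJ'J).trans hJ)
      (fun j hj => by
        rcases mem_union.1 hj with h | h
        · exact (card_le_card sdiff_subset).trans (hM j (mem_filter.1 h).1)
        · have := (mem_filter.1 h).2
          push Not at this
          exact this.2)
      (fun v => (card_le_card fun j hj => by
        simp only [mem_filter, mem_sdiff] at hj ⊢
        exact ⟨hJ'J hj.1, hj.2.1⟩).trans (hkJ v))
    have hsum : ∑ j ∈ J', γ ^ #(V j \ U) ≤ ∑ j ∈ J, γ ^ #(V j) + #U * (k * γ ^ r) := by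
      have h3 : ∀ j ∈ J', γ ^ #(V j \ U) ≤
          γ ^ #(V j) + if Disjoint (V j) U then 0 else γ ^ r := by
        intro j hj
        split_ifs with h
        · rw [sdiff_eq_self_of_disjoint h, add_zero]
        · have h4 := (mem_filter.1 hj).2.resolve_left h
          have h5 : γ ^ #(V j \ U) ≤ γ ^ r := pow_le_pow_of_le_one hγ0 hγ1 h4.le
          have h6 : 0 ≤ γ ^ #(V j) := by positivity
          linarith
      refine (sum_le_sum h3).trans ((sum_le_sum_of_subset_of_nonneg hJ'J fun j _ _ => ?_).trans ?_)
      · split_ifs <;> positivity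
      · have h6 : ∑ j ∈ J, (if Disjoint (V j) U then 0 else γ ^ r) =
            #(J.filter fun j => ¬ Disjoint (V j) U) * γ ^ r := by
          rw [← nsmul_eq_mul, ← sum_const, sum_filter]
          exact sum_congr rfl fun j _ => by rw [ite_not]
        rw [sum_add_distrib, h6]
        have h7 := card_adjacent_le J V U k hkJ
        have h8 : (#(J.filter fun j => ¬ Disjoint (V j) U) : ℝ) ≤ #U * k := by exact_mod_cast h7
        have := mul_le_mul_of_nonneg_right h8 (show 0 ≤ γ ^ r by positivity)
        linarith
    rw [hset]
    have hα : (0 : ℝ) ≤ (1 + 1 / (16 * r)) / 2 := by positivity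
    -- By `hγ`, each variable of the term pays, out of the gap between `γ` and `(1+p)/2`, for the at
    -- most `k` terms it touches.
    have h9 : ((1 + 1 / (16 * r : ℝ)) / 2) ^ #U *
        pnorm (1 / (16 * r)) (fun x => negF (J' ∪ M') (fun j => V j \ U) a x) ≤
        2 * E * γ ^ #U := by
      refine (mul_le_mul_of_nonneg_left h2 (pow_nonneg hα _)).trans ?_
      have h10 := Real.exp_le_exp.2 hsum
      rw [Real.exp_add, Real.exp_nat_mul, ← hE] at h10
      have h11 := mul_le_mul_of_nonneg_left h10 (pow_nonneg hα #U)
      have h12 := pow_le_pow_left₀ (mul_nonneg hα (Real.exp_pos _).le) hγ #U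
      rw [mul_pow] at h12
      have h13 := mul_le_mul_of_nonneg_left h12 hE0.le
      nlinarith
    nlinarith [mul_nonneg hE0.le hγu]

theorem pnorm_negF_le_exp {n : ℕ} {ι : Type*} [DecidableEq ι] {r : ℕ} (hr : 0 < r) (k : ℕ)
    {γ : ℝ} (hγ0 : 0 ≤ γ) (hγ1 : γ ≤ 1)
    (hγ : (1 + 1 / (16 * r : ℝ)) / 2 * Real.exp (k * γ ^ r) ≤ γ) (a : ι → Cube n)
    (J : Finset ι) (V : ι → Finset (Fin n)) (hk : ∀ v, #(J.filter fun i => v ∈ V i) ≤ k) :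
    pnorm (1 / (16 * r)) (negF J V a) ≤
      2 * Real.exp (∑ i ∈ J.filter (fun i => r < #(V i)), γ ^ #(V i)) := by
  have h := pnorm_negF_chain hr k hγ0 hγ1 hγ a _ (J.filter fun i => r < #(V i))
    (J.filter fun i => ¬ r < #(V i)) V le_rfl (fun i hi => not_lt.1 (mem_filter.1 hi).2)
    (fun v => (card_le_card (filter_subset_filter _ (filter_subset _ _))).trans (hk v))
  rwa [filter_union_filter_not_eq] at h

/-! ### Means over the cube; terms of large total probability -/

theorem sum_tind {n : ℕ} (b : Cube n) (U : Finset (Fin n)) :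
    avg (tind U b) = (1 / 2) ^ #U := by
  induction U using Finset.induction_on with
  | empty => simp [avg, tind]
  | insert i U hi ih =>
    rw [card_insert_of_notMem hi, pow_succ, ← ih]
    have h := sum_setc (tind (insert i U) b) i
    have h1 : setc (tind (insert i U) b) i (b i) = tind U b := by
      funext x; simp [setc, tind_insert, tind_update hi]
    have h2 : setc (tind (insert i U) b) i (-b i) = fun _ => 0 := by
      funext x
      have : -b i ≠ b i := by
        rcases Int.units_eq_one_or (b i) with h | h <;> rw [h] <;> decide
      simp [setc, tind_insert, this]
    have h3 : ∑ x, tind U b x = 2 * ∑ x, tind (insert i U) b x := by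
      rcases Int.units_eq_one_or (b i) with hb | hb <;> rw [hb] at h1 h2
      · rw [h1, h2] at h; simpa using h
      · rw [neg_neg] at h2; rw [h1, h2] at h; simpa using h
    unfold avg
    rw [h3]; ring

theorem avg_mono {n : ℕ} {f g : Cube n → ℝ} (h : ∀ x, f x ≤ g x) : avg f ≤ avg g :=
  div_le_div_of_nonneg_right (sum_le_sum fun x _ => h x) (by positivity)

theorem avg_nonneg {n : ℕ} {f : Cube n → ℝ} (h : ∀ x, 0 ≤ f x) : 0 ≤ avg f :=
  div_nonneg (sum_nonneg fun x _ => h x) (by positivity)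

theorem avg_add {n : ℕ} (f g : Cube n → ℝ) : avg (fun x => f x + g x) = avg f + avg g := by
  simp [avg, sum_add_distrib, add_div]

theorem avg_sub {n : ℕ} (f g : Cube n → ℝ) : avg (fun x => f x - g x) = avg f - avg g := by
  simp [avg, sum_sub_distrib, sub_div]

theorem avg_const_mul {n : ℕ} (c : ℝ) (f : Cube n → ℝ) :
    avg (fun x => c * f x) = c * avg f := by
  simp [avg, ← mul_sum, mul_div_assoc]

theorem avg_sum {n : ℕ} {κ : Type*} (s : Finset κ) (f : κ → Cube n → ℝ) :
    avg (fun x => ∑ i ∈ s, f i x) = ∑ i ∈ s, avg (f i) := by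
  simp only [avg, ← sum_div]
  rw [sum_comm]

theorem avg_const {n : ℕ} (c : ℝ) : avg (fun _ : Cube n => c) = c := by
  simp [avg]

/-- Functions of disjoint sets of variables are independent. -/
theorem avg_mul_of_disjoint {n : ℕ} {f g : Cube n → ℝ} {U W : Finset (Fin n)}
    (hf : DependsOn f (U : Set (Fin n))) (hg : DependsOn g (W : Set (Fin n)))
    (hUW : Disjoint U W) : avg (fun x => f x * g x) = avg f * avg g := by
  -- For two independent points, exchanging their coordinates off `U` preserves the uniform measure
  -- and, up to the names of the points, turns `f x * g y` into `f x * g x`.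
  let swap : Cube n × Cube n → Cube n × Cube n := fun q =>
    (fun v => if v ∈ U then q.1 v else q.2 v, fun v => if v ∈ U then q.2 v else q.1 v)
  have hinv : Function.Involutive swap := by
    rintro ⟨x, y⟩
    refine Prod.ext ?_ ?_ <;> funext v <;> by_cases h : v ∈ U <;> simp [swap, h]
  have h1 : ∑ q : Cube n × Cube n, f q.1 * g q.2 = ∑ q : Cube n × Cube n, f q.1 * g q.1 := by
    rw [← Equiv.sum_comp hinv.toPerm (fun q : Cube n × Cube n => f q.1 * g q.1)]
    refine sum_congr rfl fun q _ => ?_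
    congr 1
    · refine hf fun v hv => ?_
      have : v ∈ U := hv
      simp [swap, this]
    · refine hg fun v hv => ?_
      have : v ∉ U := fun h => disjoint_left.1 hUW h hv
      simp [swap, this]
  rw [Fintype.sum_prod_type, Fintype.sum_prod_type] at h1
  have h1' : (∑ i, f i) * ∑ i, g i = 2 ^ n * ∑ i, f i * g i := by
    rw [sum_mul_sum, h1]; simp [← mul_sum]
  unfold avg
  rw [div_mul_div_comm, h1']
  field_simp

theorem tind_dependsOn {n : ℕ} (U : Finset (Fin n)) (b : Cube n) :
    DependsOn (tind U b) (U : Set (Fin n)) := by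
  intro x y h
  unfold tind
  congr 1
  refine propext (forall₂_congr fun v hv => ?_)
  rw [h v hv]

theorem prod_dependsOn {n : ℕ} {ι : Type*} (I : Finset ι) (f : ι → Cube n → ℝ)
    (s : Set (Fin n)) (h : ∀ i ∈ I, DependsOn (f i) s) :
    DependsOn (fun x => ∏ i ∈ I, f i x) s :=
  fun _ _ hxy => prod_congr rfl fun i hi => h i hi hxy

theorem tind_mem {n : ℕ} (U : Finset (Fin n)) (b x : Cube n) :
    tind U b x = 0 ∨ tind U b x = 1 := by
  unfold tind; split_ifs <;> simp

theorem one_sub_tind_mem {n : ℕ} (U : Finset (Fin n)) (b x : Cube n) :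
    0 ≤ 1 - tind U b x ∧ 1 - tind U b x ≤ 1 := by
  rcases tind_mem U b x with h | h <;> rw [h] <;> norm_num

theorem negF_nonneg {n : ℕ} {ι : Type*} (I : Finset ι) (V : ι → Finset (Fin n))
    (a : ι → Cube n) (x : Cube n) : 0 ≤ negF I V a x :=
  prod_nonneg fun _ _ => (one_sub_tind_mem _ _ _).1

theorem negF_le_of_subset {n : ℕ} {ι : Type*} {I J : Finset ι} (h : J ⊆ I)
    (V : ι → Finset (Fin n)) (a : ι → Cube n) (x : Cube n) : negF I V a x ≤ negF J V a x := by
  classical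
  unfold negF
  rw [← prod_sdiff h]
  exact mul_le_of_le_one_left (negF_nonneg J V a x)
    (prod_le_one (fun _ _ => (one_sub_tind_mem _ _ _).1) fun _ _ => (one_sub_tind_mem _ _ _).2)

/-- A DNF with a large sum of the probabilities of its terms is nearly always true. -/
theorem avg_negF_le_exp {n : ℕ} {ι : Type*} [DecidableEq ι] {k u : ℕ} (hk0 : 0 < k)
    (hu0 : 0 < u) (V : ι → Finset (Fin n)) (a : ι → Cube n) (m : ℕ) : ∀ I : Finset ι, #I ≤ m →
      (∀ i ∈ I, #(V i) ≤ u) → (∀ v, #(I.filter fun i => v ∈ V i) ≤ k) →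
      avg (negF I V a) ≤ Real.exp (-(∑ i ∈ I, (1 / 2 : ℝ) ^ #(V i)) / (k * u)) := by
  have hku : (0 : ℝ) < k * u := by positivity
  induction m with
  | zero =>
    intro I hI _ _
    have : I = ∅ := card_eq_zero.1 (Nat.le_zero.1 hI)
    subst this
    simp [negF, avg]
  | succ m ih =>
    intro I hI hu hk
    rcases I.eq_empty_or_nonempty with rfl | hne
    · exact ih ∅ (by simp) hu hk
    -- A term of minimal width has maximal probability, so discarding its at most `k u` neighbours,
    -- itself included, loses at most `k u` times that probability. The remaining terms are
    -- independent of it.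
    obtain ⟨i, hi, hmin⟩ := exists_min_image I (fun i => #(V i)) hne
    rcases (V i).eq_empty_or_nonempty with hVi | ⟨v0, hv0⟩
    · have : negF I V a = fun _ => 0 := by
        funext x
        exact prod_eq_zero hi (by simp [tind, hVi])
      rw [this, avg_const]
      exact (Real.exp_pos _).le
    set J := I.filter fun j => Disjoint (V j) (V i) with hJ
    have hJI : J ⊆ I := filter_subset _ _
    have hiJ : i ∉ J := fun h => disjoint_left.1 (mem_filter.1 h).2 hv0 hv0
    have hJm : #J ≤ m := by
      have : #J < #I := card_lt_card ⟨hJI, fun h => hiJ (h hi)⟩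
      omega
    have hIH := ih J hJm (fun j hj => hu j (hJI hj))
      (fun v => (card_le_card (filter_subset_filter _ hJI)).trans (hk v))
    have h1 : avg (negF I V a) ≤ avg (fun x => (1 - tind (V i) (a i) x) * negF J V a x) := by
      refine avg_mono fun x => ?_
      have := negF_le_of_subset (insert_subset hi hJI) V a x
      refine this.trans (le_of_eq ?_)
      rw [negF, prod_insert hiJ]; rfl
    have h2 : avg (fun x => (1 - tind (V i) (a i) x) * negF J V a x) =
        avg (fun x => 1 - tind (V i) (a i) x) * avg (negF J V a) := by
      refine avg_mul_of_disjoint (U := V i) (W := J.biUnion V) ?_ ?_ ?_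
      · intro x y h
        have := tind_dependsOn (V i) (a i) h
        simp only [this]
      · refine prod_dependsOn _ _ _ fun j hj x y h => ?_
        have := tind_dependsOn (V j) (a j) (x := x) (y := y) fun v hv =>
          h v (by simpa using ⟨j, hj, hv⟩)
        simp only [this]
      · rw [disjoint_biUnion_right]
        exact fun j hj => (mem_filter.1 hj).2.symm
    rw [h2, avg_sub, avg_const, sum_tind] at h1
    set q : ℝ := (1 / 2) ^ #(V i) with hq
    have hq0 : 0 < q := by positivity
    have hsum : ∑ j ∈ I, (1 / 2 : ℝ) ^ #(V j) ≤ ∑ j ∈ J, (1 / 2 : ℝ) ^ #(V j) + k * u * q := by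
      rw [← sum_filter_add_sum_filter_not I (fun j => Disjoint (V j) (V i))]
      refine add_le_add le_rfl ?_
      have h3 : ∀ j ∈ I.filter (fun j => ¬ Disjoint (V j) (V i)), (1 / 2 : ℝ) ^ #(V j) ≤ q :=
        fun j hj => pow_le_pow_of_le_one (by norm_num) (by norm_num)
          (hmin j (mem_filter.1 hj).1)
      refine (sum_le_card_nsmul _ _ _ h3).trans ?_
      rw [nsmul_eq_mul]
      refine mul_le_mul_of_nonneg_right ?_ hq0.le
      have h4 := card_adjacent_le I V (V i) k hk
      have h5 : #(V i) * k ≤ k * u := by rw [mul_comm]; exact Nat.mul_le_mul_left _ (hu i hi)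
      exact_mod_cast h4.trans h5
    have h6 : avg (negF I V a) ≤ Real.exp (-q) *
        Real.exp (-(∑ j ∈ J, (1 / 2 : ℝ) ^ #(V j)) / (k * u)) := by
      refine h1.trans (mul_le_mul ?_ hIH (avg_nonneg fun x => negF_nonneg _ _ _ _)
        (Real.exp_pos _).le)
      have := Real.add_one_le_exp (-q); linarith
    rw [← Real.exp_add] at h6
    refine h6.trans (Real.exp_le_exp.2 ?_)
    rw [le_div_iff₀ hku, add_mul, div_mul_cancel₀ _ hku.ne']
    linarith

/-! ### Moment and avoidance bounds for locally dependent events -/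

/-- Indicators `L i`, `i ∈ W`, which are independent of those which are not near, and whose joint
occurrences have probability at most the products of the `τ i`. -/
structure LocallyDependent {n : ℕ} {ι : Type*} (W : Finset ι) (L : ι → Cube n → ℝ)
    (near : ι → ι → Prop) [DecidableRel near] (τ : ι → ℝ) (η : ℝ) : Prop where
  mem : ∀ i x, L i x = 0 ∨ L i x = 1
  indep : ∀ (θ : ℝ) (E I : Finset ι), E ⊆ W → I ⊆ W → (∀ e ∈ E, ∀ j ∈ I, ¬ near e j) →
    avg (fun x => (∏ e ∈ E, L e x) * ∏ j ∈ I, (1 + θ * L j x)) =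
      avg (fun x => ∏ e ∈ E, L e x) * avg (fun x => ∏ j ∈ I, (1 + θ * L j x))
  prod_le : ∀ E ⊆ W, avg (fun x => ∏ e ∈ E, L e x) ≤ ∏ e ∈ E, τ e
  nonneg : ∀ i, 0 ≤ τ i
  sum_near : ∀ i ∈ W, ∑ j ∈ W.filter (near i), τ j ≤ η

namespace LocallyDependent

variable {n : ℕ} {ι : Type*} {W : Finset ι} {L : ι → Cube n → ℝ}
  {near : ι → ι → Prop} [DecidableRel near] {τ : ι → ℝ} {η : ℝ}

theorem L_nonneg (h : LocallyDependent W L near τ η) (i : ι) (x : Cube n) : 0 ≤ L i x := by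
  rcases h.mem i x with h | h <;> rw [h]; norm_num

theorem L_le_one (h : LocallyDependent W L near τ η) (i : ι) (x : Cube n) : L i x ≤ 1 := by
  rcases h.mem i x with h | h <;> rw [h]; norm_num

theorem prodX_nonneg (h : LocallyDependent W L near τ η) (I : Finset ι) {θ : ℝ} (hθ : -1 ≤ θ)
    (x : Cube n) : 0 ≤ ∏ j ∈ I, (1 + θ * L j x) := by
  refine prod_nonneg fun j _ => ?_
  rcases h.mem j x with h | h <;> rw [h] <;> linarith

theorem sum_near_le (h : LocallyDependent W L near τ η) {I : Finset ι} (hI : I ⊆ W) {i : ι}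
    (hi : i ∈ W) : ∑ j ∈ I.filter (near i), τ j ≤ η :=
  (sum_le_sum_of_subset_of_nonneg (filter_subset_filter _ hI) fun j _ _ => h.nonneg j).trans
    (h.sum_near i hi)

theorem prod_near_le (h : LocallyDependent W L near τ η) (hη : η ≤ 1 / 28) {I : Finset ι}
    (hI : I ⊆ W) {i : ι} (hi : i ∈ W) : ∏ j ∈ I.filter (near i), (1 + 14 * τ j) ≤ 2 := by
  have h1 : ∏ j ∈ I.filter (near i), (1 + 14 * τ j) ≤
      ∏ j ∈ I.filter (near i), Real.exp (14 * τ j) :=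
    prod_le_prod (fun j _ => by have := h.nonneg j; linarith)
      fun j _ => by have := Real.add_one_le_exp (14 * τ j); linarith
  refine h1.trans ?_
  rw [← Real.exp_sum, ← mul_sum]
  have h2 := h.sum_near_le hI hi
  have h3 : Real.exp (14 * ∑ j ∈ I.filter (near i), τ j) ≤ Real.exp (1 / 2) :=
    Real.exp_le_exp.2 (by linarith)
  have h4 := Real.exp_bound_div_one_sub_of_interval (x := 1 / 2) (by norm_num) (by norm_num)
  norm_num at h4
  exact h3.trans h4

theorem one_le_prod (h : LocallyDependent W L near τ η) (I : Finset ι) :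
    1 ≤ ∏ j ∈ I, (1 + 14 * τ j) := by
  have := prod_le_prod (s := I) (f := fun _ => (1 : ℝ)) (g := fun j => 1 + 14 * τ j)
    (fun _ _ => zero_le_one) fun j _ => by have := h.nonneg j; linarith
  simpa using this

variable [DecidableEq ι]

theorem avg_insert (θ : ℝ) {I : Finset ι} {j : ι} (hj : j ∉ I) (g : Cube n → ℝ) :
    avg (fun x => g x * ∏ i ∈ insert j I, (1 + θ * L i x)) =
      avg (fun x => g x * ∏ i ∈ I, (1 + θ * L i x)) +
        θ * avg (fun x => L j x * g x * ∏ i ∈ I, (1 + θ * L i x)) := by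
  rw [← avg_const_mul, ← avg_add]
  congr 1; funext x
  rw [prod_insert hj]; ring

theorem avg_le_avg_insert (h : LocallyDependent W L near τ η) {I : Finset ι} {j : ι}
    (hj : j ∉ I) : avg (fun x => ∏ i ∈ I, (1 + 7 * L i x)) ≤
      avg (fun x => ∏ i ∈ insert j I, (1 + 7 * L i x)) := by
  refine avg_mono fun x => ?_
  rw [prod_insert hj]
  have := h.prodX_nonneg I (θ := 7) (by norm_num) x
  have := mul_nonneg (h.L_nonneg j x) this
  nlinarith

/-- Only factors near `E` feel the event `E`. Such a `j` is removed by expanding `1 + 7 L j`; its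
second summand adds `j` to `E`, costing `7 τ j` times at most 2 for the new neighbours of `j`
(`prod_near_le`), hence `14 τ j`. -/
theorem avg_prod_mul_le (h : LocallyDependent W L near τ η) (hη : η ≤ 1 / 28) (m : ℕ) :
    ∀ E I : Finset ι, E ⊆ W → I ⊆ W → Disjoint E I → #I ≤ m →
      avg (fun x => (∏ e ∈ E, L e x) * ∏ j ∈ I, (1 + 7 * L j x)) ≤
        (∏ e ∈ E, τ e) * (∏ j ∈ I.filter (fun j => ∃ e ∈ E, near e j), (1 + 14 * τ j)) *
          avg (fun x => ∏ j ∈ I, (1 + 7 * L j x)) := by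
  induction m with
  | zero =>
    intro E I hE hI _ hc
    have : I = ∅ := card_eq_zero.1 (Nat.le_zero.1 hc)
    subst this
    simpa [avg_const] using h.prod_le E hE
  | succ m ih =>
    intro E I hE hI hEI hc
    by_cases hex : ∃ j ∈ I, ∃ e ∈ E, near e j
    · obtain ⟨j, hjI, e, he, hej⟩ := hex
      obtain ⟨J, hjJ, rfl⟩ : ∃ J, j ∉ J ∧ insert j J = I :=
        ⟨I.erase j, notMem_erase j I, insert_erase hjI⟩
      have hJW : J ⊆ W := (subset_insert j J).trans hI
      have hjW : j ∈ W := hI hjI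
      have hJm : #J ≤ m := by rw [card_insert_of_notMem hjJ] at hc; omega
      have hjE : j ∉ E := fun h' => disjoint_left.1 hEI h' hjI
      have hEJ : Disjoint E J := disjoint_of_subset_right (subset_insert j J) hEI
      have h1 := ih E J hE hJW hEJ hJm
      have h2 := ih (insert j E) J (insert_subset hjW hE) hJW
        (disjoint_insert_left.2 ⟨hjJ, hEJ⟩) hJm
      set P := ∏ j ∈ J.filter (fun j => ∃ e ∈ E, near e j), (1 + 14 * τ j) with hP
      set X' := avg (fun x => ∏ j ∈ J, (1 + 7 * L j x)) with hX'
      have hX'0 : 0 ≤ X' := avg_nonneg fun x => h.prodX_nonneg J (by norm_num) x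
      have hP1 : 1 ≤ P := h.one_le_prod _
      have hP2 : ∏ i ∈ J.filter (fun i => ∃ e ∈ insert j E, near e i), (1 + 14 * τ i) ≤
          2 * P := by
        have hf : J.filter (fun i => ∃ e ∈ insert j E, near e i) =
            J.filter (near j) ∪ J.filter (fun i => ∃ e ∈ E, near e i) := by
          rw [← filter_or]
          refine filter_congr fun i _ => ?_
          simp
        have h3 := prod_union_inter (s₁ := J.filter (near j))
          (s₂ := J.filter (fun i => ∃ e ∈ E, near e i)) (f := fun i => 1 + 14 * τ i)
        have h4 := h.one_le_prod (J.filter (near j) ∩ J.filter (fun i => ∃ e ∈ E, near e i))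
        have h5 := h.one_le_prod (J.filter (near j) ∪ J.filter (fun i => ∃ e ∈ E, near e i))
        have h6 := h.prod_near_le hη hJW hjW
        rw [hf]
        nlinarith
      have hτE : 0 ≤ ∏ e ∈ E, τ e := prod_nonneg fun e _ => h.nonneg e
      have hτj := h.nonneg j
      rw [filter_insert, if_pos ⟨e, he, hej⟩, prod_insert (by simp [hjJ]), ← hP]
      rw [prod_insert hjE] at h2
      simp only [prod_insert hjE] at h2
      rw [avg_insert 7 hjJ]
      have h7 : τ j * (∏ e ∈ E, τ e) *
          (∏ i ∈ J.filter (fun i => ∃ e ∈ insert j E, near e i), (1 + 14 * τ i)) * X' ≤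
          τ j * (∏ e ∈ E, τ e) * (2 * P) * X' :=
        mul_le_mul_of_nonneg_right (mul_le_mul_of_nonneg_left hP2 (mul_nonneg hτj hτE)) hX'0
      calc _ ≤ (∏ e ∈ E, τ e) * P * X' + 7 * (τ j * (∏ e ∈ E, τ e) * (2 * P) * X') :=
            add_le_add h1 (mul_le_mul_of_nonneg_left (h2.trans h7) (by norm_num))
        _ = (∏ e ∈ E, τ e) * ((1 + 14 * τ j) * P) * X' := by ring
        _ ≤ _ := mul_le_mul_of_nonneg_left (h.avg_le_avg_insert hjJ)
            (mul_nonneg hτE (mul_nonneg (by linarith) (by linarith)))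
    · push Not at hex
      rw [h.indep 7 E I hE hI fun e he j hj => hex j hj e he]
      have hf : I.filter (fun j => ∃ e ∈ E, near e j) = ∅ := by
        rw [filter_eq_empty_iff]
        rintro j hj ⟨e, he, hn⟩
        exact hex j hj e he hn
      rw [hf, prod_empty, mul_one]
      exact mul_le_mul_of_nonneg_right (h.prod_le E hE)
        (avg_nonneg fun x => h.prodX_nonneg I (by norm_num) x)

/-- Unlike in `avg_prod_mul_le`, the leading term is the true mean of `L i` rather than its bound `τ
i`. This is essential: in the application the sum of the means is `O(t)`, while the available bound
for that of the `τ i` is only `k w t`. The 28 is 7 times the factor `2 * 2` for the neighbours of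
`i` and `j`. -/
theorem avg_mul_le (h : LocallyDependent W L near τ η) (hη : η ≤ 1 / 28) {i : ι} (hi : i ∈ W)
    (m : ℕ) : ∀ I ⊆ W, i ∉ I → #I ≤ m →
      avg (fun x => L i x * ∏ j ∈ I, (1 + 7 * L j x)) ≤
        (avg (L i) + 28 * τ i * ∑ j ∈ I.filter (near i), τ j) *
          avg (fun x => ∏ j ∈ I, (1 + 7 * L j x)) := by
  induction m with
  | zero =>
    intro I hI _ hc
    have : I = ∅ := card_eq_zero.1 (Nat.le_zero.1 hc)
    subst this
    simp [avg_const]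
  | succ m ih =>
    intro I hI hiI hc
    by_cases hex : ∃ j ∈ I, near i j
    · obtain ⟨j, hjI, hij⟩ := hex
      obtain ⟨J, hjJ, rfl⟩ : ∃ J, j ∉ J ∧ insert j J = I :=
        ⟨I.erase j, notMem_erase j I, insert_erase hjI⟩
      have hJW : J ⊆ W := (subset_insert j J).trans hI
      have hjW : j ∈ W := hI hjI
      have hJm : #J ≤ m := by rw [card_insert_of_notMem hjJ] at hc; omega
      have hiJ : i ∉ J := fun h' => hiI (mem_insert_of_mem h')
      have hji : j ≠ i := by rintro rfl; exact hiI (mem_insert_self _ _)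
      have h1 := ih J hJW hiJ hJm
      have h2 := h.avg_prod_mul_le hη _ {j, i} J
        (insert_subset hjW (singleton_subset_iff.2 hi)) hJW
        (by rw [disjoint_insert_left]; exact ⟨hjJ, disjoint_singleton_left.2 hiJ⟩) le_rfl
      simp only [prod_pair hji] at h2
      set X' := avg (fun x => ∏ j ∈ J, (1 + 7 * L j x)) with hX'
      have hX'0 : 0 ≤ X' := avg_nonneg fun x => h.prodX_nonneg J (by norm_num) x
      have hP2 : ∏ l ∈ J.filter (fun l => ∃ e ∈ ({j, i} : Finset ι), near e l), (1 + 14 * τ l) ≤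
          4 := by
        have hf : J.filter (fun l => ∃ e ∈ ({j, i} : Finset ι), near e l) =
            J.filter (near j) ∪ J.filter (near i) := by
          rw [← filter_or]
          exact filter_congr fun l _ => by simp
        have h3 := prod_union_inter (s₁ := J.filter (near j)) (s₂ := J.filter (near i))
          (f := fun l => 1 + 14 * τ l)
        have h4 := h.one_le_prod (J.filter (near j) ∩ J.filter (near i))
        have h5 := h.one_le_prod (J.filter (near j) ∪ J.filter (near i))
        have h6 := h.prod_near_le hη hJW hjW
        have h7 := h.prod_near_le hη hJW hi
        have h8 := h.one_le_prod (J.filter (near j))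
        rw [hf]
        nlinarith
      have hτ : 0 ≤ τ j * τ i := mul_nonneg (h.nonneg j) (h.nonneg i)
      have hs : 0 ≤ ∑ l ∈ J.filter (near i), τ l := sum_nonneg fun l _ => h.nonneg l
      have hLi : 0 ≤ avg (L i) := avg_nonneg fun x => h.L_nonneg i x
      rw [filter_insert, if_pos hij, sum_insert (by simp [hjJ]), avg_insert 7 hjJ]
      have h7 := mul_le_mul_of_nonneg_right (mul_le_mul_of_nonneg_left hP2 hτ) hX'0
      calc _ ≤ (avg (L i) + 28 * τ i * ∑ l ∈ J.filter (near i), τ l) * X' +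
            7 * (τ j * τ i * 4 * X') :=
            add_le_add h1 (mul_le_mul_of_nonneg_left (h2.trans h7) (by norm_num))
        _ = (avg (L i) + 28 * τ i * (τ j + ∑ l ∈ J.filter (near i), τ l)) * X' := by ring
        _ ≤ _ := mul_le_mul_of_nonneg_left (h.avg_le_avg_insert hjJ)
            (add_nonneg hLi (mul_nonneg (mul_nonneg (by norm_num) (h.nonneg i))
              (add_nonneg (h.nonneg j) hs)))
    · push Not at hex
      have h1 := h.indep 7 {i} I (singleton_subset_iff.2 hi) hI fun e he j hj => by
        rw [mem_singleton.1 he]; exact hex j hj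
      simp only [prod_singleton] at h1
      have hf : I.filter (near i) = ∅ := filter_eq_empty_iff.2 fun j hj => hex j hj
      rw [h1, hf, sum_empty, mul_zero, add_zero]

/-- Upper bound for the moment generating function of the number of the events which occur. -/
theorem avg_prod_le_exp (h : LocallyDependent W L near τ η) (hη : η ≤ 1 / 28) (I : Finset ι) :
    I ⊆ W → avg (fun x => ∏ j ∈ I, (1 + 7 * L j x)) ≤
      Real.exp (7 * ∑ i ∈ I, avg (L i) + 196 * η * ∑ i ∈ I, τ i) := by
  induction I using Finset.induction_on with
  | empty => intro _; simp [avg_const]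
  | insert i I hi ih =>
    intro hI
    have hiW := hI (mem_insert_self i I)
    have hIW := (subset_insert i I).trans hI
    have h1 := h.avg_mul_le hη hiW _ I hIW hi le_rfl
    have h2 := avg_insert (L := L) 7 hi (fun _ => 1)
    simp only [one_mul, mul_one] at h2
    have h3 := h.sum_near_le hIW hiW
    set X := avg (fun x => ∏ j ∈ I, (1 + 7 * L j x)) with hX
    have hX0 : 0 ≤ X := avg_nonneg fun x => h.prodX_nonneg I (by norm_num) x
    rw [h2, sum_insert hi, sum_insert hi]
    have h4 := Real.add_one_le_exp (7 * avg (L i) + 196 * η * τ i)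
    have h5 : τ i * ∑ j ∈ I.filter (near i), τ j ≤ τ i * η :=
      mul_le_mul_of_nonneg_left h3 (h.nonneg i)
    calc _ ≤ X + 7 * ((avg (L i) + 28 * τ i * ∑ j ∈ I.filter (near i), τ j) * X) := by linarith
      _ ≤ (7 * avg (L i) + 196 * η * τ i + 1) * X := by nlinarith
      _ ≤ Real.exp (7 * avg (L i) + 196 * η * τ i) *
          Real.exp (7 * ∑ i ∈ I, avg (L i) + 196 * η * ∑ i ∈ I, τ i) :=
        mul_le_mul h4 (ih hIW) hX0 (Real.exp_pos _).le
      _ = _ := by rw [← Real.exp_add]; ring_nf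

theorem one_sub_sum_le_prod (h : LocallyDependent W L near τ η) (I : Finset ι) (x : Cube n) :
    1 - ∑ j ∈ I, L j x ≤ ∏ j ∈ I, (1 + -1 * L j x) := by
  induction I using Finset.induction_on with
  | empty => simp
  | insert i I hi ih =>
    rw [sum_insert hi, prod_insert hi]
    have h1 : ∏ j ∈ I, (1 + -1 * L j x) ≤ 1 :=
      prod_le_one (fun j _ => by have := h.L_le_one j x; linarith)
        fun j _ => by have := h.L_nonneg j x; linarith
    have h2 := h.L_nonneg i x
    nlinarith

theorem prod_neg_anti (h : LocallyDependent W L near τ η) {I J : Finset ι} (hIJ : I ⊆ J)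
    (x : Cube n) : ∏ j ∈ J, (1 + -1 * L j x) ≤ ∏ j ∈ I, (1 + -1 * L j x) := by
  rw [← prod_sdiff hIJ]
  exact mul_le_of_le_one_left (h.prodX_nonneg I le_rfl x)
    (prod_le_one (fun j _ => by have := h.L_le_one j x; linarith)
      fun j _ => by have := h.L_nonneg j x; linarith)

/-- Avoiding the events in `A` costs at most a factor depending on their probabilities. -/
theorem avg_sdiff_le (h : LocallyDependent W L near τ η) {I A : Finset ι}
    (hAI : A ⊆ I)
    (hbd : ∀ j ∈ A, avg (fun x => L j x * ∏ l ∈ I \ A, (1 + -1 * L l x)) ≤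
      2 * τ j * avg (fun x => ∏ l ∈ I \ A, (1 + -1 * L l x))) :
    (1 - 2 * ∑ j ∈ A, τ j) * avg (fun x => ∏ l ∈ I \ A, (1 + -1 * L l x)) ≤
      avg (fun x => ∏ l ∈ I, (1 + -1 * L l x)) := by
  have h1 : avg (fun x => ∏ l ∈ I \ A, (1 + -1 * L l x)) -
      ∑ j ∈ A, avg (fun x => L j x * ∏ l ∈ I \ A, (1 + -1 * L l x)) ≤
      avg (fun x => ∏ l ∈ I, (1 + -1 * L l x)) := by
    rw [← avg_sum, ← avg_sub]
    refine avg_mono fun x => ?_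
    rw [← prod_sdiff hAI, ← sum_mul]
    have h2 := h.one_sub_sum_le_prod A x
    have h3 := h.prodX_nonneg (I \ A) (θ := -1) le_rfl x
    nlinarith
  have h4 := sum_le_sum hbd
  rw [← sum_mul, ← mul_sum] at h4
  linarith

/-- The local lemma: `L i` is independent of the far events, and by induction and the union bound of
`avg_sdiff_le` avoiding the near events as well costs at most a factor 2. -/
theorem avg_mul_neg_le (h : LocallyDependent W L near τ η) (hη : η ≤ 1 / 28) (m : ℕ) :
    ∀ (i : ι) (I : Finset ι), i ∈ W → I ⊆ W → i ∉ I → #I ≤ m →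
      avg (fun x => L i x * ∏ j ∈ I, (1 + -1 * L j x)) ≤
        2 * τ i * avg (fun x => ∏ j ∈ I, (1 + -1 * L j x)) := by
  induction m with
  | zero =>
    intro i I hi hI _ hc
    have : I = ∅ := card_eq_zero.1 (Nat.le_zero.1 hc)
    subst this
    have h1 := h.prod_le {i} (singleton_subset_iff.2 hi)
    have := h.nonneg i
    simp only [prod_singleton] at h1
    simp only [prod_empty, mul_one, avg_const]
    exact h1.trans (by linarith)
  | succ m ih =>
    intro i I hi hI hiI hc
    set A := I.filter (near i) with hA
    have hAI : A ⊆ I := filter_subset _ _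
    have hfar := h.indep (-1) {i} (I \ A) (singleton_subset_iff.2 hi) (sdiff_subset.trans hI)
      fun e he j hj hn => by
        rw [mem_singleton.1 he] at hn
        rw [mem_sdiff] at hj
        exact hj.2 (mem_filter.2 ⟨hj.1, hn⟩)
    have hτi := h.prod_le {i} (singleton_subset_iff.2 hi)
    simp only [prod_singleton] at hfar hτi
    set Y := avg (fun x => ∏ l ∈ I \ A, (1 + -1 * L l x)) with hY
    have hY0 : 0 ≤ Y := avg_nonneg fun x => h.prodX_nonneg _ le_rfl x
    have h1 : avg (fun x => L i x * ∏ j ∈ I, (1 + -1 * L j x)) ≤ τ i * Y := by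
      refine le_trans (avg_mono fun x => ?_) (hfar.le.trans (mul_le_mul_of_nonneg_right hτi hY0))
      exact mul_le_mul_of_nonneg_left (h.prod_neg_anti sdiff_subset x) (h.L_nonneg i x)
    have h2 : Y ≤ 2 * avg (fun x => ∏ j ∈ I, (1 + -1 * L j x)) := by
      rcases A.eq_empty_or_nonempty with hAe | hAne
      · have : Y = avg (fun x => ∏ j ∈ I, (1 + -1 * L j x)) := by rw [hY, hAe, sdiff_empty]
        rw [← this]; linarith
      have h3 := h.avg_sdiff_le hAI fun j hj => by
        refine ih j (I \ A) (hI (hAI hj)) (sdiff_subset.trans hI)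
          (fun h' => (mem_sdiff.1 h').2 hj) ?_
        have : #(I \ A) < #I := card_lt_card
          ⟨sdiff_subset, fun h' => (mem_sdiff.1 (h' (hAI hAne.choose_spec))).2 hAne.choose_spec⟩
        omega
      have h4 := h.sum_near_le hI hi
      rw [← hA] at h4
      nlinarith
    have h5 := mul_le_mul_of_nonneg_left h2 (h.nonneg i)
    linarith

/-- Upper bound for the probability that none of the events occurs. -/
theorem avg_prod_neg_le_exp (h : LocallyDependent W L near τ η) (hη : η ≤ 1 / 28)
    (I : Finset ι) : I ⊆ W → avg (fun x => ∏ j ∈ I, (1 + -1 * L j x)) ≤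
      Real.exp (-∑ i ∈ I, avg (L i) + 4 * η * ∑ i ∈ I, τ i) := by
  induction I using Finset.induction_on with
  | empty => intro _; simp [avg_const]
  | insert i I hi ih =>
    intro hI
    have hiW := hI (mem_insert_self i I)
    have hIW := (subset_insert i I).trans hI
    have h2 := avg_insert (L := L) (-1) hi (fun _ => 1)
    simp only [one_mul, mul_one] at h2
    set X := avg (fun x => ∏ j ∈ I, (1 + -1 * L j x)) with hX
    have hX0 : 0 ≤ X := avg_nonneg fun x => h.prodX_nonneg I le_rfl x
    set A := I.filter (near i) with hA
    have hAI : A ⊆ I := filter_subset _ _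
    have hfar := h.indep (-1) {i} (I \ A) (singleton_subset_iff.2 hiW) (sdiff_subset.trans hIW)
      fun e he j hj hn => by
        rw [mem_singleton.1 he] at hn
        rw [mem_sdiff] at hj
        exact hj.2 (mem_filter.2 ⟨hj.1, hn⟩)
    simp only [prod_singleton] at hfar
    -- A lower bound for the mean of `L i` times avoidance of `I` is needed. Avoiding only the far
    -- events gives exactly `avg (L i)` times at least `X`; the pairs `L i * L j` with `j` near `i`
    -- are then subtracted by a union bound.
    have hXle : X ≤ avg (fun x => ∏ j ∈ I \ A, (1 + -1 * L j x)) :=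
      avg_mono fun x => h.prod_neg_anti sdiff_subset x
    have hpair : ∀ j ∈ A, avg (fun x => L i x * L j x * ∏ l ∈ I \ A, (1 + -1 * L l x)) ≤
        4 * τ i * τ j * X := by
      intro j hj
      have hjW : j ∈ W := hIW (hAI hj)
      have hji : i ≠ j := by rintro rfl; exact hi (hAI hj)
      -- Off `B` the pair `i, j` is independent of everything; going back from `I \ B` to `I` costs
      -- a factor of at most 4, since `B` has `τ`-mass at most `2 η`.
      set B := I.filter (fun l => near i l ∨ near j l) with hB
      have hBI : B ⊆ I := filter_subset _ _
      have hAB : A ⊆ B := fun l hl => by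
        rw [hA, mem_filter] at hl
        exact mem_filter.2 ⟨hl.1, Or.inl hl.2⟩
      have h3 := h.indep (-1) {i, j} (I \ B)
        (insert_subset hiW (singleton_subset_iff.2 hjW)) (sdiff_subset.trans hIW)
        fun e he l hl hn => by
          rw [mem_sdiff] at hl
          rw [mem_insert, mem_singleton] at he
          refine hl.2 (mem_filter.2 ⟨hl.1, ?_⟩)
          rcases he with rfl | rfl
          · exact Or.inl hn
          · exact Or.inr hn
      have h4 := h.prod_le {i, j} (insert_subset hiW (singleton_subset_iff.2 hjW))
      simp only [prod_pair hji] at h3 h4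
      set Y := avg (fun x => ∏ l ∈ I \ B, (1 + -1 * L l x)) with hY
      have hY0 : 0 ≤ Y := avg_nonneg fun x => h.prodX_nonneg _ le_rfl x
      have h5 : Y ≤ 4 * X := by
        have h6 := h.avg_sdiff_le hBI fun l hl =>
          h.avg_mul_neg_le hη _ l (I \ B) (hIW (hBI hl)) (sdiff_subset.trans hIW)
            (fun h' => (mem_sdiff.1 h').2 hl) le_rfl
        have h7 : ∑ l ∈ B, τ l ≤ 2 * η := by
          rw [hB, filter_or]
          have h8 := sum_union_inter (s₁ := I.filter (near i)) (s₂ := I.filter (near j)) (f := τ)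
          have h9 : 0 ≤ ∑ l ∈ I.filter (near i) ∩ I.filter (near j), τ l :=
            sum_nonneg fun l _ => h.nonneg l
          have h10 := h.sum_near_le hIW hiW
          have h11 := h.sum_near_le hIW hjW
          linarith
        nlinarith
      calc _ ≤ avg (fun x => L i x * L j x * ∏ l ∈ I \ B, (1 + -1 * L l x)) :=
            avg_mono fun x => mul_le_mul_of_nonneg_left
              (h.prod_neg_anti (sdiff_subset_sdiff le_rfl hAB) x)
              (mul_nonneg (h.L_nonneg i x) (h.L_nonneg j x))
        _ = avg (fun x => L i x * L j x) * Y := h3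
        _ ≤ (τ i * τ j) * (4 * X) := mul_le_mul h4 h5 hY0
            (mul_nonneg (h.nonneg i) (h.nonneg j))
        _ = _ := by ring
    have h12 : avg (fun x => L i x * ∏ l ∈ I \ A, (1 + -1 * L l x)) -
        ∑ j ∈ A, avg (fun x => L i x * L j x * ∏ l ∈ I \ A, (1 + -1 * L l x)) ≤
        avg (fun x => L i x * ∏ l ∈ I, (1 + -1 * L l x)) := by
      rw [← avg_sum, ← avg_sub]
      refine avg_mono fun x => ?_
      rw [← prod_sdiff hAI, ← sum_mul, ← mul_sum]
      have h2 := h.one_sub_sum_le_prod A x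
      have h3 := mul_nonneg (h.L_nonneg i x) (h.prodX_nonneg (I \ A) (θ := -1) le_rfl x)
      nlinarith
    have h13 := sum_le_sum hpair
    rw [← sum_mul, ← mul_sum] at h13
    have h14 := h.sum_near_le hIW hiW
    rw [← hA] at h14
    have hLi : 0 ≤ avg (L i) := avg_nonneg fun x => h.L_nonneg i x
    have h15 : 4 * τ i * (∑ j ∈ A, τ j) * X ≤ 4 * τ i * η * X :=
      mul_le_mul_of_nonneg_right (mul_le_mul_of_nonneg_left h14
        (mul_nonneg (by norm_num) (h.nonneg i))) hX0
    have h16 := mul_le_mul_of_nonneg_left hXle hLi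
    rw [h2, sum_insert hi, sum_insert hi]
    have h17 := Real.add_one_le_exp (-avg (L i) + 4 * η * τ i)
    calc _ ≤ (-avg (L i) + 4 * η * τ i + 1) * X := by nlinarith
      _ ≤ Real.exp (-avg (L i) + 4 * η * τ i) *
          Real.exp (-∑ i ∈ I, avg (L i) + 4 * η * ∑ i ∈ I, τ i) :=
        mul_le_mul h17 (ih hIW) hX0 (Real.exp_pos _).le
      _ = _ := by rw [← Real.exp_add]; ring_nf

end LocallyDependent

/-! ### Unions of formulas and products of disjoint terms -/

theorem negF_eq_ite {n : ℕ} {ι : Type*} (I : Finset ι) (V : ι → Finset (Fin n))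
    (a : ι → Cube n) (x : Cube n) :
    negF I V a x = if ∀ i ∈ I, tind (V i) (a i) x = 0 then 1 else 0 := by
  unfold negF
  split_ifs with h
  · exact prod_eq_one fun i hi => by rw [h i hi, sub_zero]
  · push Not at h
    obtain ⟨i, hi, hne⟩ := h
    exact prod_eq_zero hi (by rw [(tind_mem _ _ _).resolve_left hne, sub_self])

theorem negF_union {n : ℕ} {ι : Type*} [DecidableEq ι] (I J : Finset ι)
    (V : ι → Finset (Fin n)) (a : ι → Cube n) (x : Cube n) :
    negF (I ∪ J) V a x = negF I V a x * negF J V a x := by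
  simp only [negF_eq_ite, forall_mem_union]
  split_ifs <;> simp_all

theorem negF_biUnion {n : ℕ} {ι κ : Type*} [DecidableEq ι] [DecidableEq κ] (A : Finset κ)
    (P : κ → Finset ι) (V : ι → Finset (Fin n)) (a : ι → Cube n) (x : Cube n) :
    negF (A.biUnion P) V a x = ∏ i ∈ A, negF (P i) V a x := by
  induction A using Finset.induction_on with
  | empty => simp [negF]
  | insert i A hi ih => rw [biUnion_insert, negF_union, prod_insert hi, ih]

theorem negF_dependsOn {n : ℕ} {ι : Type*} (I : Finset ι) (V : ι → Finset (Fin n))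
    (a : ι → Cube n) (s : Set (Fin n)) (h : ∀ i ∈ I, (V i : Set (Fin n)) ⊆ s) :
    DependsOn (negF I V a) s := by
  refine prod_dependsOn _ _ _ fun i hi x y hxy => ?_
  have := tind_dependsOn (V i) (a i) (x := x) (y := y) fun v hv => hxy v (h i hi hv)
  simp only [this]

theorem tind_mul_tind {n : ℕ} {U U' : Finset (Fin n)} (hd : Disjoint U U') (b b' x : Cube n) :
    tind U b x * tind U' b' x = tind (U ∪ U') (asg U b b') x := by
  unfold tind
  have h : (∀ v ∈ U ∪ U', x v = asg U b b' v) ↔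
      (∀ v ∈ U, x v = b v) ∧ ∀ v ∈ U', x v = b' v := by
    rw [forall_mem_union]
    refine and_congr (forall₂_congr fun v hv => ?_) (forall₂_congr fun v hv => ?_)
    · rw [asg, if_pos hv]
    · rw [asg, if_neg fun h => disjoint_left.1 hd h hv]
  simp only [h]
  split_ifs <;> simp_all

/-- A product of terms with disjoint sets of variables is a term. -/
theorem exists_prod_tind_eq {n : ℕ} {ι : Type*} [DecidableEq ι] (V : ι → Finset (Fin n))
    (a : ι → Cube n) (A : Finset ι) :
    (∀ i ∈ A, ∀ j ∈ A, i ≠ j → Disjoint (V i) (V j)) →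
      ∃ b, ∀ x, ∏ i ∈ A, tind (V i) (a i) x = tind (A.biUnion V) b x := by
  induction A using Finset.induction_on with
  | empty => intro _; exact ⟨1, fun x => by simp [tind]⟩
  | insert i A hi ih =>
    intro h
    obtain ⟨b, hb⟩ := ih fun j hj l hl =>
      h j (mem_insert_of_mem hj) l (mem_insert_of_mem hl)
    have hd : Disjoint (V i) (A.biUnion V) := by
      rw [disjoint_biUnion_right]
      exact fun j hj => h i (mem_insert_self _ _) j (mem_insert_of_mem hj)
        (by rintro rfl; exact hi hj)
    refine ⟨asg (V i) (a i) b, fun x => ?_⟩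
    rw [prod_insert hi, hb, tind_mul_tind hd, biUnion_insert]

/-! ### Truncated inclusion-exclusion -/

/-- Truncated inclusion-exclusion for events with few simultaneous occurrences. -/
theorem truncation_sq_le {ι : Type*} (W : Finset ι) (L : ι → ℝ)
    (hL : ∀ i, L i = 0 ∨ L i = 1) (m : ℕ) :
    (∏ i ∈ W, (1 - L i) - ∑ A ∈ W.powerset.filter (fun A => #A ≤ m),
      (-1) ^ #A * ∏ i ∈ A, L i) ^ 2 ≤ (1 / 2) ^ m * ∏ i ∈ W, (1 + 7 * L i) := by
  have hL0 : ∀ i, 0 ≤ L i := fun i => by rcases hL i with h | h <;> rw [h]; norm_num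
  have h1 : ∏ i ∈ W, (1 - L i) = ∑ A ∈ W.powerset, (-1) ^ #A * ∏ i ∈ A, L i := by
    have : ∀ i, 1 - L i = 1 + -L i := fun i => by ring
    simp only [this, prod_one_add, prod_neg]
  rw [h1, ← sum_filter_add_sum_filter_not W.powerset (fun A => #A ≤ m), add_sub_cancel_left]
  set R := ∑ A ∈ W.powerset.filter (fun A => ¬ #A ≤ m), ∏ i ∈ A, L i with hR
  have hR0 : 0 ≤ R := sum_nonneg fun A _ => prod_nonneg fun i _ => hL0 i
  have h2 : |∑ A ∈ W.powerset.filter (fun A => ¬ #A ≤ m), (-1) ^ #A * ∏ i ∈ A, L i| ≤ R := by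
    refine (abs_sum_le_sum_abs _ _).trans (sum_le_sum fun A _ => ?_)
    rw [abs_mul, abs_pow, abs_neg, abs_one, one_pow, one_mul,
      abs_of_nonneg (prod_nonneg fun i _ => hL0 i)]
  have h3 : R ≤ ∏ i ∈ W, (1 + L i) := by
    rw [prod_one_add]
    exact sum_le_sum_of_subset_of_nonneg (filter_subset _ _)
      fun A _ _ => prod_nonneg fun i _ => hL0 i
  have h4 : R ≤ (1 / 2) ^ m * ∏ i ∈ W, (1 + 2 * L i) := by
    rw [prod_one_add, mul_sum]
    refine (sum_le_sum fun A hA => ?_).trans (sum_le_sum_of_subset_of_nonneg (filter_subset _ _)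
      fun A _ _ => mul_nonneg (by positivity)
        (prod_nonneg fun i _ => mul_nonneg zero_le_two (hL0 i)))
    have hm : m ≤ #A := by have := (mem_filter.1 hA).2; omega
    rw [prod_mul_distrib, prod_const, ← mul_assoc]
    refine le_mul_of_one_le_left (prod_nonneg fun i _ => hL0 i) ?_
    have : (2 : ℝ) ^ m ≤ 2 ^ #A := pow_le_pow_right₀ (by norm_num) hm
    rw [div_pow, one_pow, one_div, inv_mul_eq_div, one_le_div (by positivity)]
    exact this
  -- The square of the remainder is bounded by the product of two different bounds, one with and one
  -- without the gain `2⁻ᵐ`. The 7 only has to satisfy `2 * 3 ≤ 1 + 7`.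
  have h5 : (∏ i ∈ W, (1 + L i)) * ∏ i ∈ W, (1 + 2 * L i) ≤ ∏ i ∈ W, (1 + 7 * L i) := by
    rw [← prod_mul_distrib]
    refine prod_le_prod (fun i _ => ?_) fun i _ => ?_
    · have := hL0 i; positivity
    · rcases hL i with h | h <;> rw [h] <;> norm_num
  have h6 : R * R ≤ (∏ i ∈ W, (1 + L i)) * ((1 / 2) ^ m * ∏ i ∈ W, (1 + 2 * L i)) :=
    mul_le_mul h3 h4 hR0 (prod_nonneg fun i _ => by have := hL0 i; linarith)
  have h7 := mul_le_mul_of_nonneg_left h5 (show (0 : ℝ) ≤ (1 / 2) ^ m by positivity)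
  rw [← sq_abs]
  have h8 := mul_self_le_mul_self (abs_nonneg _) h2
  nlinarith

/-- Rankin's trick: a set of size at most `m` may be weighted by `y ^ #A / y ^ m ≥ 1`. A small `y`
tames a large sum of the `c i` at the price `y ^ (-m)`. -/
theorem sum_prod_le {ι : Type*} (W : Finset ι) (c : ι → ℝ) (hc : ∀ i, 0 ≤ c i)
    {y : ℝ} (hy0 : 0 < y) (hy1 : y ≤ 1) (m : ℕ) :
    ∑ A ∈ W.powerset.filter (fun A => #A ≤ m), ∏ i ∈ A, c i ≤
      (y ^ m)⁻¹ * Real.exp (y * ∑ i ∈ W, c i) := by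
  have h1 : ∑ A ∈ W.powerset.filter (fun A => #A ≤ m), ∏ i ∈ A, c i ≤
      (y ^ m)⁻¹ * ∏ i ∈ W, (1 + y * c i) := by
    rw [prod_one_add, mul_sum]
    refine (sum_le_sum fun A hA => ?_).trans (sum_le_sum_of_subset_of_nonneg (filter_subset _ _)
      fun A _ _ => mul_nonneg (by positivity)
        (prod_nonneg fun i _ => mul_nonneg hy0.le (hc i)))
    have hm : #A ≤ m := (mem_filter.1 hA).2
    rw [prod_mul_distrib, prod_const, ← mul_assoc]
    refine le_mul_of_one_le_left (prod_nonneg fun i _ => hc i) ?_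
    rw [inv_mul_eq_div, one_le_div (by positivity)]
    exact pow_le_pow_of_le_one hy0.le hy1 hm
  refine h1.trans (mul_le_mul_of_nonneg_left ?_ (by positivity))
  rw [mul_sum, Real.exp_sum]
  exact prod_le_prod (fun i _ => by have := hc i; positivity)
    fun i _ => by have := Real.add_one_le_exp (y * c i); linarith

/-! ### Leaders and the approximating function -/

section Leaders

variable {n : ℕ} {ι : Type*} [LinearOrder ι] (W : Finset ι) (V : ι → Finset (Fin n))
  (a : ι → Cube n)

/-- The terms before `i` which share a variable with it. -/
def prev (i : ι) : Finset ι := W.filter fun j => j < i ∧ ¬ Disjoint (V j) (V i)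

/-- Indicator that the term `i` is satisfied, but no earlier term which shares a variable
with it. -/
noncomputable def leader (i : ι) (x : Cube n) : ℝ :=
  tind (V i) (a i) x * negF (prev W V i) V a x

/-- The variables of the terms which share a variable with the term `i`. -/
def ball (i : ι) : Finset (Fin n) := (W.filter fun j => ¬ Disjoint (V j) (V i)).biUnion V

/-- The leader events of `i` and `j` have a variable in common. -/
def Near (i j : ι) : Prop := ¬ Disjoint (ball W V i) (ball W V j)

instance : DecidableRel (Near W V) := fun i j => by unfold Near; infer_instance

theorem leader_mem (i : ι) (x : Cube n) : leader W V a i x = 0 ∨ leader W V a i x = 1 := by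
  unfold leader
  rw [negF_eq_ite]
  rcases tind_mem (V i) (a i) x with h | h <;> rw [h] <;> split_ifs <;> simp

theorem leader_le_tind (i : ι) (x : Cube n) : leader W V a i x ≤ tind (V i) (a i) x := by
  unfold leader
  rw [negF_eq_ite]
  rcases tind_mem (V i) (a i) x with h | h <;> rw [h] <;> split_ifs <;> simp

/-- The first satisfied term is always a leader, so if some term is satisfied then some leader event
occurs. -/
theorem negF_eq_prod_leader (x : Cube n) :
    negF W V a x = ∏ i ∈ W, (1 - leader W V a i x) := by
  rw [negF_eq_ite]
  split_ifs with h
  · exact (prod_eq_one fun i hi => by rw [leader, h i hi, zero_mul, sub_zero]).symm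
  · push Not at h
    have hne : (W.filter fun i => tind (V i) (a i) x ≠ 0).Nonempty := by
      obtain ⟨i, hi, h⟩ := h
      exact ⟨i, mem_filter.2 ⟨hi, h⟩⟩
    obtain ⟨hi, hi1⟩ := mem_filter.1 (min'_mem _ hne)
    refine (prod_eq_zero hi ?_).symm
    have h2 : negF (prev W V (min' _ hne)) V a x = 1 := by
      rw [negF_eq_ite, if_pos]
      intro j hj
      obtain ⟨hjW, hjlt, _⟩ := mem_filter.1 hj
      by_contra hne'
      exact absurd (min'_le _ j (mem_filter.2 ⟨hjW, hne'⟩)) (not_le.2 hjlt)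
    rw [leader, (tind_mem _ _ _).resolve_left hi1, h2]; norm_num

theorem leader_dependsOn {i : ι} (hi : i ∈ W) (hV : (V i).Nonempty) :
    DependsOn (leader W V a i) (ball W V i : Set (Fin n)) := by
  have hmem : i ∈ W.filter fun j => ¬ Disjoint (V j) (V i) := by
    obtain ⟨v, hv⟩ := hV
    exact mem_filter.2 ⟨hi, fun h => disjoint_left.1 h hv hv⟩
  intro x y hxy
  have h1 := tind_dependsOn (V i) (a i) (x := x) (y := y) fun v hv =>
    hxy v (mem_coe.2 (mem_biUnion.2 ⟨i, hmem, hv⟩))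
  have h2 := negF_dependsOn (prev W V i) V a (ball W V i : Set (Fin n)) (fun j hj v hv => by
    obtain ⟨hjW, _, hj⟩ := mem_filter.1 hj
    exact mem_coe.2 (mem_biUnion.2 ⟨j, mem_filter.2 ⟨hjW, hj⟩, hv⟩)) hxy
  simp only [leader, h1, h2]

theorem prod_leader_eq_zero {A : Finset ι} (hA : A ⊆ W) {i j : ι} (hi : i ∈ A) (hj : j ∈ A)
    (hij : i ≠ j) (hadj : ¬ Disjoint (V i) (V j)) (x : Cube n) :
    ∏ e ∈ A, leader W V a e x = 0 := by
  wlog hlt : i < j generalizing i j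
  · exact this hj hi hij.symm (fun h => hadj h.symm) (lt_of_le_of_ne (not_lt.1 hlt) hij.symm)
  rcases tind_mem (V i) (a i) x with h | h
  · exact prod_eq_zero hi (by rw [leader, h, zero_mul])
  · refine prod_eq_zero hj ?_
    have : negF (prev W V j) V a x = 0 :=
      prod_eq_zero (mem_filter.2 ⟨hA hi, hlt, hadj⟩) (by rw [h, sub_self])
    rw [leader, this, mul_zero]

theorem prod_one_add_dependsOn (hV : ∀ i ∈ W, (V i).Nonempty) {I : Finset ι} (hI : I ⊆ W)
    (θ : ℝ) : DependsOn (fun x => ∏ j ∈ I, (1 + θ * leader W V a j x))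
      ((I.biUnion (ball W V) : Finset (Fin n)) : Set (Fin n)) := by
  refine prod_dependsOn _ _ _ fun j hj x y h => ?_
  have := leader_dependsOn W V a (hI hj) (hV j (hI hj)) (x := x) (y := y) fun v hv =>
    h v (mem_coe.2 (mem_biUnion.2 ⟨j, hj, mem_coe.1 hv⟩))
  simp only [this]

theorem prod_leader_dependsOn (hV : ∀ i ∈ W, (V i).Nonempty) {I : Finset ι} (hI : I ⊆ W) :
    DependsOn (fun x => ∏ j ∈ I, leader W V a j x)
      ((I.biUnion (ball W V) : Finset (Fin n)) : Set (Fin n)) :=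
  prod_dependsOn _ _ _ fun j hj _ _ h =>
    leader_dependsOn W V a (hI hj) (hV j (hI hj)) fun v hv =>
      h v (mem_coe.2 (mem_biUnion.2 ⟨j, hj, mem_coe.1 hv⟩))

/-- Leaders that share a variable exclude each other; if all terms in `A` are pairwise disjoint,
they are independent and dominate their leader events. -/
theorem avg_prod_leader_le {A : Finset ι} (hA : A ⊆ W) :
    avg (fun x => ∏ i ∈ A, leader W V a i x) ≤ ∏ i ∈ A, (1 / 2 : ℝ) ^ #(V i) := by
  by_cases h : ∀ i ∈ A, ∀ j ∈ A, i ≠ j → Disjoint (V i) (V j)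
  · obtain ⟨b, hb⟩ := exists_prod_tind_eq V a A h
    have h1 : avg (fun x => ∏ i ∈ A, leader W V a i x) ≤ avg (tind (A.biUnion V) b) := by
      refine avg_mono fun x => ?_
      rw [← hb]
      refine prod_le_prod (fun i _ => ?_) fun i _ => leader_le_tind W V a i x
      rcases leader_mem W V a i x with h | h <;> rw [h]; norm_num
    rw [sum_tind, card_biUnion (fun i hi j hj hij => h i hi j hj hij), ← prod_pow_eq_pow_sum] at h1
    exact h1
  · push Not at h
    obtain ⟨i, hi, j, hj, hij, hadj⟩ := h
    simp only [prod_leader_eq_zero W V a hA hi hj hij hadj, avg_const]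
    positivity

/-- A path count: the ball of `i` has at most `w k w` variables, each lies in at most `k` terms, and
each of these has at most `w k` neighbours. -/
theorem card_near_le {k w : ℕ} (hk : ∀ v, #(W.filter fun j => v ∈ V j) ≤ k)
    (hw : ∀ i ∈ W, #(V i) ≤ w) {i : ι} (hi : i ∈ W) :
    #(W.filter (Near W V i)) ≤ (k * w) ^ 3 := by
  have hadj : ∀ j ∈ W, #(W.filter fun l => ¬ Disjoint (V l) (V j)) ≤ w * k := fun j hj =>
    (card_adjacent_le W V (V j) k hk).trans (Nat.mul_le_mul_right _ (hw j hj))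
  have hball : #(ball W V i) ≤ w * k * w := by
    refine (card_biUnion_le_card_mul _ _ w fun j hj => hw j (mem_filter.1 hj).1).trans ?_
    exact Nat.mul_le_mul_right _ (hadj i hi)
  have hsub : W.filter (Near W V i) ⊆ (W.filter fun l => ¬ Disjoint (V l) (ball W V i)).biUnion
      fun l => W.filter fun j => ¬ Disjoint (V j) (V l) := by
    intro j hj
    obtain ⟨hjW, hn⟩ := mem_filter.1 hj
    obtain ⟨v, hvi, hvj⟩ := not_disjoint_iff.1 hn
    obtain ⟨l, hl, hvl⟩ := mem_biUnion.1 hvj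
    obtain ⟨hlW, hlj⟩ := mem_filter.1 hl
    exact mem_biUnion.2 ⟨l, mem_filter.2 ⟨hlW, not_disjoint_iff.2 ⟨v, hvl, hvi⟩⟩,
      mem_filter.2 ⟨hjW, fun h => hlj h.symm⟩⟩
  calc _ ≤ #(W.filter fun l => ¬ Disjoint (V l) (ball W V i)) * (w * k) :=
        (card_le_card hsub).trans (card_biUnion_le_card_mul _ _ _ fun l hl =>
          hadj l (mem_filter.1 hl).1)
    _ ≤ (w * k * w * k) * (w * k) := Nat.mul_le_mul_right _
        ((card_adjacent_le W V _ k hk).trans (Nat.mul_le_mul_right _ hball))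
    _ = _ := by ring

theorem leader_locallyDependent {k w w0 : ℕ} (hk : ∀ v, #(W.filter fun j => v ∈ V j) ≤ k)
    (hw : ∀ i ∈ W, #(V i) ≤ w) (hw0 : 0 < w0) (hW : ∀ i ∈ W, w0 ≤ #(V i)) :
    LocallyDependent W (leader W V a) (Near W V) (fun i => (1 / 2 : ℝ) ^ #(V i))
      ((k * w : ℝ) ^ 3 * (1 / 2) ^ w0) where
  mem := leader_mem W V a
  indep := by
    intro θ E I hE hI hfar
    have hV : ∀ i ∈ W, (V i).Nonempty := fun i hi => card_pos.1 (hw0.trans_le (hW i hi))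
    refine avg_mul_of_disjoint (prod_leader_dependsOn W V a hV hE)
      (prod_one_add_dependsOn W V a hV hI θ) ?_
    rw [disjoint_biUnion_left]
    intro e he
    rw [disjoint_biUnion_right]
    exact fun j hj => not_not.1 (hfar e he j hj)
  prod_le := fun E hE => avg_prod_leader_le W V a hE
  nonneg := fun i => by positivity
  sum_near := by
    intro i hi
    have h1 : ∀ j ∈ W.filter (Near W V i), (1 / 2 : ℝ) ^ #(V j) ≤ (1 / 2) ^ w0 := fun j hj =>
      pow_le_pow_of_le_one (by norm_num) (by norm_num) (hW j (mem_filter.1 hj).1)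
    refine (sum_le_card_nsmul _ _ _ h1).trans ?_
    rw [nsmul_eq_mul]
    refine mul_le_mul_of_nonneg_right ?_ (by positivity)
    exact_mod_cast card_near_le W V hk hw hi

/-- For pairwise disjoint terms the product of leaders is one big term on `U` times a negated DNF.
All predecessor terms meet `U`, so they cost at most `γ ^ r` each if still wide, which is absorbed
as in `pnorm_negF_chain`; only the terms of `M` contribute to the exponent. If two terms meet, the
product vanishes. -/
theorem pnorm_prod_leader_le {r : ℕ} (hr : 0 < r) (k : ℕ)
    {γ : ℝ} (hγ0 : 0 ≤ γ) (hγ1 : γ ≤ 1)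
    (hγ : (1 + 1 / (16 * r : ℝ)) / 2 * Real.exp (k * γ ^ r) ≤ γ) (M : Finset ι)
    (hk : ∀ v, #((W ∪ M).filter fun i => v ∈ V i) ≤ k) {A : Finset ι} (hA : A ⊆ W) :
    pnorm (1 / (16 * r)) (fun x => (∏ i ∈ A, leader W V a i x) * negF M V a x) ≤
      2 * Real.exp (∑ i ∈ M.filter (fun i => r < #(V i)), γ ^ #(V i)) *
        ∏ i ∈ A, γ ^ #(V i) := by
  by_cases hdis : ∀ i ∈ A, ∀ j ∈ A, i ≠ j → Disjoint (V i) (V j)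
  swap
  · push Not at hdis
    obtain ⟨i, hi, j, hj, hij, hadj⟩ := hdis
    simp only [prod_leader_eq_zero W V a hA hi hj hij hadj, zero_mul]
    have : pnorm (1 / (16 * r : ℝ)) (fun _ : Cube n => (0 : ℝ)) = 0 := by
      simp [pnorm, wsum, fourierCoef]
    rw [this]
    positivity
  obtain ⟨b, hb⟩ := exists_prod_tind_eq V a A hdis
  set U := A.biUnion V with hU
  set P := A.biUnion (prev W V) with hP
  have h1 : ∀ x, (∏ i ∈ A, leader W V a i x) * negF M V a x =
      tind U b x * negF (P ∪ M) V a x := by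
    intro x
    rw [negF_union, hP, negF_biUnion, ← hb]
    simp only [leader, prod_mul_distrib]; ring
  have hcard : γ ^ #U = ∏ i ∈ A, γ ^ #(V i) := by
    rw [prod_pow_eq_pow_sum, hU, card_biUnion (fun i hi j hj hij => hdis i hi j hj hij)]
  have hPW : P ⊆ W := biUnion_subset.2 fun i _ => filter_subset _ _
  simp only [h1]
  rw [pnorm_tind_mul, ← hcard]
  simp only [negF_asg]
  set J := compat (P ∪ M) V a U b with hJ
  have hJsub : J ⊆ W ∪ M := (filter_subset _ _).trans (union_subset_union_left hPW)
  have h2 := pnorm_negF_le_exp hr k hγ0 hγ1 hγ a J (fun j => V j \ U)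
    (fun v => (card_le_card fun j hj => by
      simp only [mem_filter, mem_sdiff] at hj ⊢
      exact ⟨hJsub hj.1, hj.2.1⟩).trans (hk v))
  set Ψ := ∑ i ∈ M.filter (fun i => r < #(V i)), γ ^ #(V i) with hΨ
  have h3 : ∑ i ∈ J.filter (fun i => r < #(V i \ U)), γ ^ #(V i \ U) ≤
      Ψ + #U * (k * γ ^ r) := by
    set J' := J.filter (fun i => r < #(V i \ U)) with hJ'
    rw [← sum_filter_add_sum_filter_not J' (fun i => Disjoint (V i) U)]
    refine add_le_add ?_ ?_
    · have h4 : ∀ i ∈ J'.filter (fun i => Disjoint (V i) U), γ ^ #(V i \ U) = γ ^ #(V i) :=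
        fun i hi => by rw [sdiff_eq_self_of_disjoint (mem_filter.1 hi).2]
      rw [sum_congr rfl h4]
      refine sum_le_sum_of_subset_of_nonneg (fun i hi => ?_) fun i _ _ => by positivity
      obtain ⟨hi, hid⟩ := mem_filter.1 hi
      obtain ⟨hi, hir⟩ := mem_filter.1 hi
      rw [sdiff_eq_self_of_disjoint hid] at hir
      refine mem_filter.2 ⟨?_, hir⟩
      rcases mem_union.1 (mem_filter.1 hi).1 with h | h
      · exfalso
        obtain ⟨e, he, hie⟩ := mem_biUnion.1 h
        obtain ⟨v, hv, hve⟩ := not_disjoint_iff.1 (mem_filter.1 hie).2.2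
        exact disjoint_left.1 hid hv (mem_biUnion.2 ⟨e, he, hve⟩)
      · exact h
    · have h5 : ∀ i ∈ J'.filter (fun i => ¬ Disjoint (V i) U), γ ^ #(V i \ U) ≤ γ ^ r :=
        fun i hi => pow_le_pow_of_le_one hγ0 hγ1 (mem_filter.1 (mem_filter.1 hi).1).2.le
      refine (sum_le_card_nsmul _ _ _ h5).trans ?_
      rw [nsmul_eq_mul, ← mul_assoc]
      refine mul_le_mul_of_nonneg_right ?_ (by positivity)
      have h6 := card_adjacent_le (W ∪ M) V U k hk
      have h7 : #(J'.filter fun i => ¬ Disjoint (V i) U) ≤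
          #((W ∪ M).filter fun i => ¬ Disjoint (V i) U) :=
        card_le_card (filter_subset_filter _ ((filter_subset _ _).trans hJsub))
      exact_mod_cast h7.trans h6
  have hα : (0 : ℝ) ≤ (1 + 1 / (16 * r)) / 2 := by positivity
  have h8 := Real.exp_le_exp.2 h3
  rw [Real.exp_add, Real.exp_nat_mul] at h8
  have h9 := pow_le_pow_left₀ (mul_nonneg hα (Real.exp_pos _).le) hγ #U
  rw [mul_pow] at h9
  calc _ ≤ ((1 + 1 / (16 * r : ℝ)) / 2) ^ #U *
        (2 * (Real.exp Ψ * Real.exp (k * γ ^ r) ^ #U)) :=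
        mul_le_mul_of_nonneg_left (h2.trans (mul_le_mul_of_nonneg_left h8 zero_le_two))
          (pow_nonneg hα _)
    _ = 2 * Real.exp Ψ * (((1 + 1 / (16 * r : ℝ)) / 2) ^ #U *
        Real.exp (k * γ ^ r) ^ #U) := by ring
    _ ≤ _ := mul_le_mul_of_nonneg_left h9 (by positivity)

/-- Approximation of the negation of a DNF by a function with a small damped Fourier norm. -/
theorem exists_approx {r : ℕ} (hr : 0 < r) (k : ℕ)
    {γ : ℝ} (hγ0 : 0 ≤ γ) (hγ1 : γ ≤ 1)
    (hγ : (1 + 1 / (16 * r : ℝ)) / 2 * Real.exp (k * γ ^ r) ≤ γ) (M : Finset ι)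
    (hk : ∀ v, #((W ∪ M).filter fun i => v ∈ V i) ≤ k) (m : ℕ) {y : ℝ} (hy0 : 0 < y)
    (hy1 : y ≤ 1) :
    ∃ g : Cube n → ℝ,
      avg (fun x => (negF (W ∪ M) V a x - g x) ^ 2) ≤
        (1 / 2) ^ m * avg (fun x => ∏ i ∈ W, (1 + 7 * leader W V a i x)) ∧
      pnorm (1 / (16 * r)) g ≤
        2 * Real.exp (∑ i ∈ M.filter (fun i => r < #(V i)), γ ^ #(V i)) *
          ((y ^ m)⁻¹ * Real.exp (y * ∑ i ∈ W, γ ^ #(V i))) := by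
  -- Inclusion-exclusion is truncated only for the leaders of `W`; the factor of `M` is kept
  -- exactly, being bounded by 1 and of controlled damped norm.
  refine ⟨fun x => ∑ A ∈ W.powerset.filter (fun A => #A ≤ m),
    (-1) ^ #A * ((∏ i ∈ A, leader W V a i x) * negF M V a x), ?_, ?_⟩
  · rw [← avg_const_mul]
    refine avg_mono fun x => ?_
    have h1 : negF (W ∪ M) V a x - ∑ A ∈ W.powerset.filter (fun A => #A ≤ m),
        (-1) ^ #A * ((∏ i ∈ A, leader W V a i x) * negF M V a x) =
        negF M V a x * (∏ i ∈ W, (1 - leader W V a i x) -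
          ∑ A ∈ W.powerset.filter (fun A => #A ≤ m), (-1) ^ #A * ∏ i ∈ A, leader W V a i x) := by
      rw [negF_union, ← negF_eq_prod_leader, mul_sub, mul_sum, mul_comm]
      congr 1
      exact sum_congr rfl fun A _ => by ring
    rw [h1, mul_pow]
    have h2 := truncation_sq_le W (fun i => leader W V a i x) (fun i => leader_mem W V a i x) m
    have h3 : negF M V a x ^ 2 ≤ 1 := by
      rw [negF_eq_ite]; split_ifs <;> norm_num
    exact (mul_le_of_le_one_left (sq_nonneg _) h3).trans h2
  · have hp0 : (0 : ℝ) ≤ 1 / (16 * r) := by positivity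
    refine (pnorm_sum_le hp0 _ _ _).trans ?_
    have h1 : ∀ A ∈ W.powerset.filter (fun A => #A ≤ m), |(-1 : ℝ) ^ #A| *
        pnorm (1 / (16 * r)) (fun x => (∏ i ∈ A, leader W V a i x) * negF M V a x) ≤
        2 * Real.exp (∑ i ∈ M.filter (fun i => r < #(V i)), γ ^ #(V i)) *
          ∏ i ∈ A, γ ^ #(V i) := by
      intro A hA
      rw [abs_pow, abs_neg, abs_one, one_pow, one_mul]
      exact pnorm_prod_leader_le W V a hr k hγ0 hγ1 hγ M hk
        (mem_powerset.1 (mem_filter.1 hA).1)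
    refine (sum_le_sum h1).trans ?_
    rw [← mul_sum]
    exact mul_le_mul_of_nonneg_left
      (sum_prod_le W _ (fun i => by positivity) hy0 hy1 m) (by positivity)

end Leaders

/-! ### From approximation to concentration; the degree tail -/

/-- A function with small Fourier tail which is close to a function with small damped norm is
concentrated on few coefficients. -/
theorem exists_family {n : ℕ} (h g : Cube n → ℝ) {ε p B : ℝ} {D : ℕ} (hε : 0 < ε) (hp0 : 0 < p)
    (hp1 : p ≤ 1) (hB : 0 < B)
    (htail : ∑ S ∈ univ.filter (fun S => D < #S), fourierCoef h S ^ 2 ≤ ε / 4)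
    (happ : avg (fun x => (h x - g x) ^ 2) ≤ ε / 8) (hg : pnorm p g ≤ B) :
    ∃ 𝒮 : Finset (Finset (Fin n)), (#𝒮 : ℝ) ≤ 8 * (B / p ^ D) ^ 2 / ε ∧
      ∑ S ∈ 𝒮ᶜ, fourierCoef h S ^ 2 ≤ ε := by
  set Λ := B / p ^ D with hΛ
  have hΛ0 : 0 < Λ := by positivity
  -- Discarded low-degree coefficients of `g` have square sum at most `θ Λ = ε/8`. With the factor 2
  -- for passing from `g` to `h`, the three errors are at most `ε/4` each.
  set θ := ε / (8 * Λ) with hθ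
  have hθ0 : 0 < θ := by positivity
  have hsum : ∑ S ∈ univ.filter (fun S : Finset (Fin n) => #S ≤ D), |fourierCoef g S| ≤ Λ := by
    rw [hΛ, le_div_iff₀ (by positivity), sum_mul]
    refine le_trans (sum_le_sum fun S hS => ?_) ((sum_le_sum_of_subset_of_nonneg
      (filter_subset _ univ) fun S _ _ => ?_).trans hg)
    · rw [prod_const, mul_comm]
      exact mul_le_mul_of_nonneg_right
        (pow_le_pow_of_le_one hp0.le hp1 (mem_filter.1 hS).2) (abs_nonneg _)
    · exact mul_nonneg (prod_nonneg fun _ _ => hp0.le) (abs_nonneg _)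
  refine ⟨univ.filter fun S => #S ≤ D ∧ θ ≤ |fourierCoef g S|, ?_, ?_⟩
  · have h1 : (#(univ.filter fun S : Finset (Fin n) => #S ≤ D ∧ θ ≤ |fourierCoef g S|) : ℝ) * θ ≤
        Λ := by
      rw [← nsmul_eq_mul, ← sum_const]
      refine le_trans (sum_le_sum fun S hS => (mem_filter.1 hS).2.2)
        ((sum_le_sum_of_subset_of_nonneg (fun S hS => ?_) fun S _ _ => abs_nonneg _).trans hsum)
      exact mem_filter.2 ⟨mem_univ _, (mem_filter.1 hS).2.1⟩
    rw [← le_div_iff₀ hθ0] at h1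
    refine h1.trans (le_of_eq ?_)
    rw [hθ]; field_simp
  · have hpt : ∀ S ∈ (univ.filter fun S => #S ≤ D ∧ θ ≤ |fourierCoef g S|)ᶜ,
        fourierCoef h S ^ 2 ≤ (if D < #S then fourierCoef h S ^ 2 else 0) +
          2 * θ * (if #S ≤ D then |fourierCoef g S| else 0) +
          2 * fourierCoef (fun x => h x - g x) S ^ 2 := by
      intro S hS
      rw [mem_compl, mem_filter, not_and, not_and] at hS
      rw [fourierCoef_sub]
      by_cases hD : #S ≤ D
      · have h1 := not_le.1 (hS (mem_univ _) hD)
        rw [if_neg (not_lt.2 hD), if_pos hD]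
        have h2 : fourierCoef g S ^ 2 ≤ θ * |fourierCoef g S| := by
          rw [← sq_abs, sq]
          exact mul_le_mul_of_nonneg_right h1.le (abs_nonneg _)
        nlinarith [sq_nonneg (fourierCoef h S - 2 * fourierCoef g S)]
      · rw [if_pos (not_le.1 hD), if_neg hD]
        nlinarith [sq_nonneg (fourierCoef h S - fourierCoef g S)]
    refine (sum_le_sum hpt).trans ((sum_le_sum_of_subset_of_nonneg (subset_univ _)
      fun S _ _ => ?_).trans ?_)
    · split_ifs <;> positivity
    · rw [sum_add_distrib, sum_add_distrib, ← mul_sum, ← mul_sum, parseval, ← sum_filter,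
        ← sum_filter]
      have h1 : 2 * θ * Λ = ε / 4 := by rw [hθ]; field_simp; norm_num
      have h2 := mul_le_mul_of_nonneg_left hsum (show 0 ≤ 2 * θ by positivity)
      linarith

theorem tail_negF_le {n : ℕ} {ι : Type*} [DecidableEq ι] {w : ℕ} (hw : 0 < w) (I : Finset ι)
    (V : ι → Finset (Fin n)) (a : ι → Cube n) (hV : ∀ i ∈ I, #(V i) ≤ w) (D : ℕ) :
    ∑ S ∈ univ.filter (fun S => D < #S), fourierCoef (negF I V a) S ^ 2 ≤
      2 / (1 + 1 / (16 * w : ℝ)) ^ D := by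
  have hx : (1 : ℝ) ≤ 1 + 1 / (16 * w : ℝ) := le_add_of_nonneg_right (by positivity)
  rw [le_div_iff₀ (by positivity), sum_mul]
  refine le_trans (sum_le_sum fun S hS => ?_) ((sum_le_sum_of_subset_of_nonneg
    (filter_subset _ univ) fun S _ _ => ?_).trans (sum_sq_negF_le hw I V a hV))
  · rw [mul_comm]
    exact mul_le_mul_of_nonneg_right
      (pow_le_pow_right₀ hx (mem_filter.1 hS).2.le) (sq_nonneg _)
  · positivity

/-! ### Numerical parameters -/

/-- Choice of the parameter of the chain lemma. -/
theorem gamma_param (k : ℕ) : (1 + 1 / (16 * (24 * Nat.clog 2 (k + 2) + 8 : ℕ) : ℝ)) / 2 *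
    Real.exp (k * (11 / 20) ^ (24 * Nat.clog 2 (k + 2) + 8)) ≤ 11 / 20 := by
  set l := Nat.clog 2 (k + 2) with hl
  have h1 : k + 2 ≤ 2 ^ l := Nat.le_pow_clog (by norm_num) _
  have h2 : (k : ℝ) ≤ 2 ^ l := by
    have : (k + 2 : ℝ) ≤ 2 ^ l := by exact_mod_cast h1
    linarith
  -- Far less than 24 would do here; that factor is dictated by the comparison `4 * lw + 8 ≤ 24 * l
  -- + 8` in `negF_concentrated`.
  have h3 : (11 / 20 : ℝ) ^ (24 * l + 8) ≤ (1 / 2) ^ l * (1 / 100) := by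
    rw [pow_add, pow_mul]
    exact mul_le_mul (pow_le_pow_left₀ (by positivity) (by norm_num) _) (by norm_num)
      (by positivity) (by positivity)
  have h4 : (k : ℝ) * (11 / 20) ^ (24 * l + 8) ≤ 1 / 100 := by
    calc _ ≤ (2 : ℝ) ^ l * ((1 / 2) ^ l * (1 / 100)) :=
          mul_le_mul h2 h3 (by positivity) (by positivity)
      _ = 1 / 100 := by rw [← mul_assoc, ← mul_pow]; norm_num
  have h5 := Real.exp_bound_div_one_sub_of_interval (x := 1 / 100) (by norm_num) (by norm_num)
  have h6 := Real.exp_le_exp.2 h4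
  have h7 : (1 / (16 * (24 * l + 8 : ℕ)) : ℝ) ≤ 1 / 128 := by
    refine one_div_le_one_div_of_le (by norm_num) ?_
    push_cast
    have : (0 : ℝ) ≤ l := by positivity
    linarith
  have h8 : (1 + 1 / (16 * (24 * l + 8 : ℕ) : ℝ)) / 2 ≤ 129 / 256 := by linarith
  calc _ ≤ (129 / 256 : ℝ) * (1 / (1 - 1 / 100)) :=
        mul_le_mul h8 (h6.trans h5) (Real.exp_pos _).le (by norm_num)
    _ ≤ _ := by norm_num

theorem two_pow_clog_le (x : ℕ) (hx : 0 < x) : 2 ^ Nat.clog 2 x ≤ 2 * x := by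
  rcases Nat.lt_or_ge 1 x with h | h
  · have h1 := Nat.pow_pred_clog_lt_self (b := 2) (by norm_num) h
    have h2 : 0 < Nat.clog 2 x := Nat.clog_pos (by norm_num) h
    rw [Nat.pred_eq_sub_one] at h1
    calc 2 ^ Nat.clog 2 x = 2 * 2 ^ (Nat.clog 2 x - 1) := by
          rw [← pow_succ', Nat.sub_add_cancel h2]
      _ ≤ 2 * x := by omega
  · have : x = 1 := by omega
    subst this; simp

/-- Widths logarithmic in `k w` cost little when `k` is small compared to `w`. -/
theorem narrow_cost {k w : ℕ} (hk : 0 < k) (hw : 0 < w) (hkw : k ^ 5 ≤ w) :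
    (11 / 10 : ℝ) ^ (4 * Nat.clog 2 (k * w) + 8) * (k * (4 * Nat.clog 2 (k * w) + 8 : ℕ)) ≤
      220 * w := by
  have h1 := two_pow_clog_le (k * w) (Nat.mul_pos hk hw)
  set l := Nat.clog 2 (k * w) with hl
  have h1' : (2 : ℝ) ^ l ≤ 2 * (k * w) := by exact_mod_cast h1
  have hkw' : (k : ℝ) ^ 5 ≤ w := by exact_mod_cast hkw
  have hw0 : (0 : ℝ) < w := by exact_mod_cast hw
  have hk0 : (0 : ℝ) < k := by exact_mod_cast hk
  -- As `79/50 < 2 ^ (2/3)`, the left side is of order at most `(k w)^(2/3) k = k^(5/3) w^(2/3)`;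
  -- this is the source of the hypothesis `k ^ 5 ≤ w`. The base leaves room for `(11/10)^4` and for
  -- a slow exponential `1.079 ^ l` majorizing the linear factor.
  have h2 : (79 / 50 : ℝ) ^ l * k ≤ 2 * w := by
    refine le_of_pow_le_pow_left₀ (n := 3) (by norm_num) (by positivity) ?_
    calc ((79 / 50 : ℝ) ^ l * (k : ℝ)) ^ 3 = ((79 / 50 : ℝ) ^ 3) ^ l * (k : ℝ) ^ 3 := by
          rw [mul_pow, ← pow_mul, ← pow_mul, mul_comm l 3]
      _ ≤ ((2 : ℝ) ^ 2) ^ l * (k : ℝ) ^ 3 := mul_le_mul_of_nonneg_right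
          (pow_le_pow_left₀ (by positivity) (by norm_num) _) (by positivity)
      _ = ((2 : ℝ) ^ l) ^ 2 * (k : ℝ) ^ 3 := by rw [← pow_mul, ← pow_mul, mul_comm l 2]
      _ ≤ (2 * ((k : ℝ) * (w : ℝ))) ^ 2 * (k : ℝ) ^ 3 := mul_le_mul_of_nonneg_right
          (pow_le_pow_left₀ (by positivity) h1' 2) (by positivity)
      _ = 4 * (w : ℝ) ^ 2 * (k : ℝ) ^ 5 := by ring
      _ ≤ 4 * (w : ℝ) ^ 2 * (w : ℝ) := mul_le_mul_of_nonneg_left hkw' (by positivity)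
      _ ≤ (2 * (w : ℝ)) ^ 3 := by
        have : (0 : ℝ) < (w : ℝ) ^ 3 := by positivity
        nlinarith
  have h3 : (4 * l + 8 : ℝ) ≤ 51 * (1079 / 1000) ^ l := by
    have := one_add_mul_le_pow (a := (79 / 1000 : ℝ)) (by norm_num) l
    norm_num at this
    have : (0 : ℝ) ≤ l := by positivity
    linarith
  have h4 : (11 / 10 : ℝ) ^ (4 * l + 8) ≤ (1464100 / 1000000) ^ l * (215 / 100) := by
    rw [pow_add, pow_mul]
    exact mul_le_mul (le_of_eq (by norm_num)) (by norm_num) (by positivity) (by positivity)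
  have h5 : ((1464100 / 1000000 : ℝ)) ^ l * (1079 / 1000) ^ l ≤ (79 / 50) ^ l := by
    rw [← mul_pow]
    exact pow_le_pow_left₀ (by norm_num) (by norm_num) _
  push_cast
  calc _ ≤ ((1464100 / 1000000 : ℝ) ^ l * (215 / 100)) * (k * (51 * (1079 / 1000) ^ l)) :=
        mul_le_mul h4 (mul_le_mul_of_nonneg_left h3 hk0.le) (by positivity) (by positivity)
    _ = (215 * 51 / 100) * k * ((1464100 / 1000000) ^ l * (1079 / 1000) ^ l) := by ring
    _ ≤ (215 * 51 / 100) * k * (79 / 50) ^ l :=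
        mul_le_mul_of_nonneg_left h5 (by positivity)
    _ = (215 * 51 / 100) * ((79 / 50) ^ l * k) := by ring
    _ ≤ (215 * 51 / 100) * (2 * w) := mul_le_mul_of_nonneg_left h2 (by positivity)
    _ ≤ 220 * w := by linarith

theorem exp_half_le {x : ℝ} (h0 : 0 ≤ x) (h1 : x ≤ 1) : Real.exp (x / 2) ≤ 1 + x := by
  have h2 := Real.exp_bound_div_one_sub_of_interval (x := x / 2) (by linarith) (by linarith)
  refine h2.trans ?_
  rw [div_le_iff₀ (by linarith)]
  nlinarith

/-- The number of coefficients in terms of the parameters of the proof. -/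
theorem count_le {k w D : ℕ} {t ε B : ℝ} (hk : 0 < k) (hX : 1 ≤ w * t) (ht : 0 ≤ t)
    (hw : 1 ≤ w) (hε : ε = Real.exp (-t)) (hε1 : 0 < B) (hB : B ≤ Real.exp (260 * (w * t)))
    (hD : (D : ℝ) ≤ 97 * (w * t)) :
    8 * (B / (1 / (16 * (24 * Nat.clog 2 (k + 2) + 8 : ℕ) : ℝ)) ^ D) ^ 2 / ε + 1 ≤
      Real.logb 2 ((k : ℝ) + 2) ^ (6000 * (w : ℝ) * Real.logb 2 (1 / ε)) := by
  have hw' : (1 : ℝ) ≤ w := by exact_mod_cast hw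
  set X := (w : ℝ) * t with hXdef
  set l := Nat.clog 2 (k + 2) with hl
  set lg := Real.logb 2 ((k : ℝ) + 2) with hlg
  have hl1 : (2 : ℝ) ^ l ≤ 2 * (k + 2) := by exact_mod_cast two_pow_clog_le (k + 2) (by omega)
  have hk1 : (1 : ℝ) ≤ k := by exact_mod_cast hk
  have hl2 : (l : ℝ) ≤ lg + 1 := by
    have h1 := Real.logb_le_logb_of_le (b := 2) (by norm_num) (by positivity) hl1
    rw [Real.logb_mul (by norm_num) (by positivity), Real.logb_self_eq_one (by norm_num),
      Real.logb_pow, Real.logb_self_eq_one (by norm_num)] at h1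
    linarith
  have hlg1 : 3 / 2 ≤ lg := by
    rw [hlg, Real.le_logb_iff_rpow_le (by norm_num) (by positivity)]
    have h1 : ((2 : ℝ) ^ (3 / 2 : ℝ)) ≤ 3 := by
      have h2 : ((2 : ℝ) ^ (3 / 2 : ℝ)) ^ 2 = 8 := by
        rw [← Real.rpow_natCast, ← Real.rpow_mul (by norm_num)]; norm_num
      nlinarith [Real.rpow_nonneg (show (0 : ℝ) ≤ 2 by norm_num) (3 / 2)]
    linarith
  set u := Real.log lg with hu
  have hlgu : lg = Real.exp u := (Real.exp_log (by linarith)).symm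
  have hu1 : 2 / 5 ≤ u := by
    rw [hu, Real.le_log_iff_exp_le (by linarith)]
    have h1 : Real.exp (2 / 5) ≤ 3 / 2 := by
      refine le_of_pow_le_pow_left₀ (n := 5) (by norm_num) (by norm_num) ?_
      rw [← Real.exp_nat_mul]
      have h3 : Real.exp ((5 : ℕ) * (2 / 5)) = Real.exp 1 * Real.exp 1 := by
        rw [← Real.exp_add]; norm_num
      rw [h3]
      have := Real.exp_one_lt_d9
      have := Real.exp_pos 1
      nlinarith
    linarith
  have he1 := Real.exp_one_gt_d9
  -- Here `1/p` is at most a power of `lg`: the constant `727 ≤ exp 7` is absorbed because `7 ≤ 18 *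
  -- u`, thanks to `u ≥ 2/5`.
  have hr : (16 * (24 * l + 8 : ℕ) : ℝ) ≤ Real.exp (19 * u) := by
    have h1 : (16 * (24 * l + 8 : ℕ) : ℝ) ≤ 727 * lg := by push_cast; linarith
    have h2 : (727 : ℝ) ≤ Real.exp 7 := by
      have h3 : Real.exp 7 = Real.exp 1 ^ 7 := by rw [← Real.exp_nat_mul]; norm_num
      rw [h3]
      calc (727 : ℝ) ≤ 2.7 ^ 7 := by norm_num
        _ ≤ _ := pow_le_pow_left₀ (by norm_num) (by linarith) _
    calc _ ≤ Real.exp 7 * Real.exp u := h1.trans (by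
            rw [← hlgu]; exact mul_le_mul_of_nonneg_right h2 (by linarith))
      _ ≤ _ := by rw [← Real.exp_add]; exact Real.exp_le_exp.2 (by linarith)
  have hrD : (16 * (24 * l + 8 : ℕ) : ℝ) ^ D ≤ Real.exp (1843 * u * X) := by
    refine (pow_le_pow_left₀ (by positivity) hr D).trans ?_
    rw [← Real.exp_nat_mul]
    refine Real.exp_le_exp.2 ?_
    nlinarith
  have h8 : (9 : ℝ) ≤ Real.exp 3 := by
    have h3 : Real.exp 3 = Real.exp 1 ^ 3 := by rw [← Real.exp_nat_mul]; norm_num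
    rw [h3]
    calc (9 : ℝ) ≤ 2.7 ^ 3 := by norm_num
      _ ≤ _ := pow_le_pow_left₀ (by norm_num) (by linarith) _
  have htX : t ≤ X := by nlinarith
  have h9 : B / (1 / (16 * (24 * l + 8 : ℕ) : ℝ)) ^ D ≤
      Real.exp (260 * X + 1843 * u * X) := by
    rw [one_div, inv_pow, div_inv_eq_mul, Real.exp_add]
    exact mul_le_mul hB hrD (by positivity) (Real.exp_pos _).le
  have h9' : 0 ≤ B / (1 / (16 * (24 * l + 8 : ℕ) : ℝ)) ^ D := by positivity
  have h10 : (B / (1 / (16 * (24 * l + 8 : ℕ) : ℝ)) ^ D) ^ 2 / ε ≤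
      Real.exp (2 * (260 * X + 1843 * u * X) + t) := by
    rw [hε, Real.exp_neg, div_inv_eq_mul, Real.exp_add]
    refine mul_le_mul_of_nonneg_right ?_ (Real.exp_pos _).le
    refine (pow_le_pow_left₀ h9' h9 2).trans (le_of_eq ?_)
    rw [← Real.exp_nat_mul]; norm_num
  have h11 : 1 ≤ Real.exp (2 * (260 * X + 1843 * u * X) + t) := Real.one_le_exp (by positivity)
  have hlogb : t ≤ Real.logb 2 (1 / ε) := by
    rw [hε, one_div, ← Real.exp_neg, neg_neg, Real.logb, Real.log_exp,
      le_div_iff₀ (Real.log_pos (by norm_num))]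
    have := Real.log_two_lt_d9
    nlinarith
  calc _ ≤ 9 * Real.exp (2 * (260 * X + 1843 * u * X) + t) := by
        rw [mul_div_assoc]; linarith
    _ ≤ Real.exp 3 * Real.exp (2 * (260 * X + 1843 * u * X) + t) :=
        mul_le_mul_of_nonneg_right h8 (Real.exp_pos _).le
    -- The terms without `u` total at most `(520 + 1 + 3) X ≤ 1310 u X`, and `2 * 1843 + 1310 <
    -- 6000`. It matters that `lg` is bounded away from 1, so that `exp (O(X))` is a power of it.
    _ ≤ Real.exp (u * (6000 * X)) := by
        rw [← Real.exp_add]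
        refine Real.exp_le_exp.2 ?_
        have : 0 ≤ (u - 2 / 5) * X := mul_nonneg (by linarith) (by linarith)
        nlinarith
    _ ≤ Real.exp (u * (6000 * w * Real.logb 2 (1 / ε))) := by
        refine Real.exp_le_exp.2 (mul_le_mul_of_nonneg_left ?_ (by linarith))
        rw [mul_assoc]
        exact mul_le_mul_of_nonneg_left (mul_le_mul_of_nonneg_left hlogb (by linarith))
          (by norm_num)
    _ = _ := by rw [Real.rpow_def_of_pos (by linarith)]

/-- The sum of the probabilities of the terms of a DNF which is not nearly always true. -/
theorem sum_prob_le {n : ℕ} {ι : Type*} [DecidableEq ι] {k u : ℕ} (hk0 : 0 < k) (hu0 : 0 < u)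
    {V : ι → Finset (Fin n)} {a : ι → Cube n} {I J : Finset ι} (hJ : J ⊆ I) {t : ℝ}
    (hu : ∀ i ∈ J, #(V i) ≤ u) (hk : ∀ v, #(I.filter fun i => v ∈ V i) ≤ k)
    (ht : Real.exp (-t) < avg (negF I V a)) :
    ∑ i ∈ J, (1 / 2 : ℝ) ^ #(V i) ≤ k * u * t := by
  have h1 := avg_negF_le_exp hk0 hu0 V a _ J le_rfl hu
    fun v => (card_le_card (filter_subset_filter _ hJ)).trans (hk v)
  have h2 := (ht.trans_le (avg_mono (negF_le_of_subset hJ V a))).trans_le h1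
  rw [Real.exp_lt_exp, lt_div_iff₀ (by positivity)] at h2
  linarith

/-- This turns bounds on sums of probabilities, base `1/2`, into bounds for the base `γ = 11/20` of
the chain lemma. -/
theorem pow_gamma_le {x z : ℕ} (h : x ≤ z) :
    (11 / 20 : ℝ) ^ x ≤ (11 / 10) ^ z * (1 / 2) ^ x := by
  have h1 : (11 / 20 : ℝ) ^ x = (11 / 10) ^ x * (1 / 2) ^ x := by rw [← mul_pow]; norm_num
  rw [h1]
  exact mul_le_mul_of_nonneg_right (pow_le_pow_right₀ (by norm_num) h) (by positivity)

/-- Since `26 log 2 > 18`, the product is at most `exp (-3t) = ε exp (-2t)`. -/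
theorem truncation_param {ε t : ℝ} {m : ℕ} (hεt : ε = Real.exp (-t)) (ht1 : 1 ≤ t)
    (h16 : 16 ≤ Real.exp (2 * t)) (hm1 : 26 * t ≤ m) :
    (1 / 2 : ℝ) ^ m * Real.exp (15 * t) ≤ ε / 8 := by
  have h1 : (1 / 2 : ℝ) ^ m ≤ Real.exp (-(18 * t)) := by
    have h2 : (1 / 2 : ℝ) = Real.exp (-Real.log 2) := by
      rw [Real.exp_neg, Real.exp_log (by norm_num)]; norm_num
    rw [h2, ← Real.exp_nat_mul]
    refine Real.exp_le_exp.2 ?_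
    have := Real.log_two_gt_d9
    nlinarith
  calc _ ≤ Real.exp (-(18 * t)) * Real.exp (15 * t) :=
        mul_le_mul_of_nonneg_right h1 (Real.exp_pos _).le
    _ = Real.exp (-t) * Real.exp (-(2 * t)) := by
        rw [← Real.exp_add, ← Real.exp_add]; ring_nf
    _ ≤ Real.exp (-t) * (1 / 8) := by
        refine mul_le_mul_of_nonneg_left ?_ (Real.exp_pos _).le
        rw [Real.exp_neg, ← one_div]
        exact one_div_le_one_div_of_le (by norm_num) (by linarith)
    _ = ε / 8 := by rw [hεt]; ring

/-- The exponents, in units of `w t`, add up as `1 + 220 + 38 + 1`, where `38 > 27 * log 4`. -/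
theorem norm_param {w m : ℕ} {t Ψ z : ℝ} (hwr : (1 : ℝ) ≤ w) (ht1 : 1 ≤ t)
    (hm2 : (m : ℝ) ≤ 27 * t) (hΨ : Ψ ≤ 220 * (w * t)) (hyW : z ≤ t) :
    2 * Real.exp Ψ * ((((1 / 4 : ℝ) ^ w) ^ m)⁻¹ * Real.exp z) ≤ Real.exp (260 * (w * t)) := by
  have hX : (1 : ℝ) ≤ w * t := by nlinarith
  have h1 : (((1 / 4 : ℝ) ^ w) ^ m)⁻¹ ≤ Real.exp (38 * (w * t)) := by
    have h2 : (1 / 4 : ℝ) = Real.exp (-(2 * Real.log 2)) := by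
      rw [Real.exp_neg, two_mul, Real.exp_add, Real.exp_log (by norm_num)]; norm_num
    rw [h2, ← Real.exp_nat_mul, ← Real.exp_nat_mul, ← Real.exp_neg]
    refine Real.exp_le_exp.2 ?_
    have h3 := Real.log_two_lt_d9
    have h4 : (m : ℝ) * w ≤ 27 * (w * t) := by nlinarith
    have h5 : (0 : ℝ) ≤ m * w := by positivity
    nlinarith
  have h2 : (2 : ℝ) ≤ Real.exp (w * t) := by
    have := Real.add_one_le_exp ((w : ℝ) * t); linarith
  have h3 : t ≤ w * t := by nlinarith
  calc _ ≤ Real.exp (w * t) * Real.exp (220 * (w * t)) *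
        (Real.exp (38 * (w * t)) * Real.exp (w * t)) := by
        refine mul_le_mul (mul_le_mul h2 (Real.exp_le_exp.2 hΨ) (Real.exp_pos _).le
          (Real.exp_pos _).le) (mul_le_mul h1 (Real.exp_le_exp.2 (hyW.trans h3))
          (Real.exp_pos _).le (Real.exp_pos _).le) (by positivity) (by positivity)
    _ = _ := by rw [← Real.exp_add, ← Real.exp_add, ← Real.exp_add]; ring_nf

/-- From `1 + x ≥ exp (x/2)` with `x = 1/(16w)`, degree `96 w t` yields a decay of `exp (-3t)`. -/
theorem tail_param {w D : ℕ} {ε t : ℝ} (hwr : (1 : ℝ) ≤ w) (hεt : ε = Real.exp (-t))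
    (h16 : 16 ≤ Real.exp (2 * t)) (hD1 : 96 * (w * t) ≤ D) :
    2 / (1 + 1 / (16 * w : ℝ)) ^ D ≤ ε / 4 := by
  have hε : 0 < ε := hεt ▸ Real.exp_pos _
  have hx0 : (0 : ℝ) ≤ 1 / (16 * w) := by positivity
  have hx1 : (1 / (16 * w) : ℝ) ≤ 1 := by rw [div_le_one (by positivity)]; linarith
  have h1 : Real.exp (3 * t) ≤ (1 + 1 / (16 * w : ℝ)) ^ D := by
    refine le_trans ?_ (pow_le_pow_left₀ (Real.exp_pos _).le (exp_half_le hx0 hx1) D)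
    rw [← Real.exp_nat_mul]
    refine Real.exp_le_exp.2 ?_
    have h2 : 3 * t = 96 * (w * t) * (1 / (16 * w) / 2) := by field_simp; ring
    rw [h2]
    exact mul_le_mul_of_nonneg_right hD1 (by positivity)
  rw [div_le_iff₀ (by positivity)]
  have h2 : ε * Real.exp (3 * t) = Real.exp (2 * t) := by
    rw [hεt, ← Real.exp_add]; ring_nf
  have h3 := mul_le_mul_of_nonneg_left h1 hε.le
  linarith

/-! ### Assembly of the bounds -/

/-- Fourier concentration of the negation of a DNF, away from the degenerate cases. -/
theorem negF_concentrated {n : ℕ} {ι : Type*} [LinearOrder ι] {k w : ℕ} (hk0 : 0 < k)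
    (hw0 : 0 < w) {V : ι → Finset (Fin n)} {a : ι → Cube n} {I : Finset ι}
    (hw : ∀ i ∈ I, #(V i) ≤ w) (hk : ∀ v, #(I.filter fun i => v ∈ V i) ≤ k) {ε : ℝ} (hε : 0 < ε)
    (hε4 : ε < 1 / 4) (havg : ε < avg (negF I V a)) :
    ∃ 𝒮 : Finset (Finset (Fin n)), (#𝒮 : ℝ) + 1 ≤
        Real.logb 2 ((k : ℝ) + 2) ^ (6000 * (w : ℝ) * Real.logb 2 (1 / ε)) ∧
      ∑ S ∈ 𝒮ᶜ, fourierCoef (negF I V a) S ^ 2 ≤ ε := by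
  set t := -Real.log ε with ht
  have hεt : ε = Real.exp (-t) := by rw [ht, neg_neg, Real.exp_log hε]
  have het : 4 ≤ Real.exp t := by
    have h1 : Real.exp t * ε = 1 := by rw [hεt, ← Real.exp_add]; simp
    nlinarith [Real.exp_pos t]
  have ht1 : 1 ≤ t := by
    by_contra h
    have h1 := Real.exp_lt_exp.2 (not_le.1 h)
    have := Real.exp_one_lt_d9
    linarith
  have hwr : (1 : ℝ) ≤ w := by exact_mod_cast hw0
  have hkr : (1 : ℝ) ≤ k := by exact_mod_cast hk0
  have hX : (1 : ℝ) ≤ w * t := by nlinarith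
  set lw := Nat.clog 2 (k * w) with hlw
  -- The 4 makes `2 ^ (-w0)` beat `(k w)^4`: three powers from the count of near events and one from
  -- the bound `k w t` on the total probability. The 8 leaves the margin `1/256`.
  set w0 := 4 * lw + 8 with hw0def
  set l := Nat.clog 2 (k + 2) with hl
  set r := 24 * l + 8 with hr
  have hlw2 : (k * w : ℝ) ≤ 2 ^ lw := by
    have : k * w ≤ 2 ^ lw := Nat.le_pow_clog (by norm_num) _
    exact_mod_cast this
  set W := I.filter fun i => w0 ≤ #(V i) with hW
  set M := I.filter fun i => ¬ w0 ≤ #(V i) with hM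
  have hWM : W ∪ M = I := filter_union_filter_not_eq _ _
  have hWI : W ⊆ I := filter_subset _ _
  have hMI : M ⊆ I := filter_subset _ _
  have hkW : ∀ v, #(W.filter fun i => v ∈ V i) ≤ k := fun v =>
    (card_le_card (filter_subset_filter _ hWI)).trans (hk v)
  have havg' : Real.exp (-t) < avg (negF I V a) := hεt ▸ havg
  -- the wide terms
  have hSW : ∑ i ∈ W, (1 / 2 : ℝ) ^ #(V i) ≤ k * w * t :=
    sum_prob_le hk0 hw0 hWI (fun i hi => hw i (hWI hi)) hk havg'
  have hSM : ∑ i ∈ M, (1 / 2 : ℝ) ^ #(V i) ≤ k * w0 * t :=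
    sum_prob_le hk0 (by omega) hMI (fun i hi => (not_le.1 (mem_filter.1 hi).2).le) hk havg'
  have hLD := leader_locallyDependent W V a hkW (fun i hi => hw i (hWI hi))
    (w0 := w0) (by omega) (fun i hi => (mem_filter.1 hi).2)
  set η : ℝ := (k * w : ℝ) ^ 3 * (1 / 2) ^ w0 with hη
  have hη0 : 0 ≤ η := by positivity
  have hkw1 : (1 : ℝ) ≤ k * w := by nlinarith
  have hηkw : η * (k * w) ≤ 1 / 256 := by
    have h1 : η * (k * w) = (k * w : ℝ) ^ 4 * (1 / 2) ^ w0 := by rw [hη]; ring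
    have h2 : (k * w : ℝ) ^ 4 ≤ (2 ^ lw) ^ 4 := pow_le_pow_left₀ (by positivity) hlw2 4
    have h3 : (2 ^ lw : ℝ) ^ 4 * (1 / 2) ^ w0 = 1 / 256 := by
      rw [hw0def, pow_add, ← pow_mul, mul_comm lw 4, ← mul_assoc, ← mul_pow]
      norm_num
    rw [h1, ← h3]
    exact mul_le_mul_of_nonneg_right h2 (by positivity)
  have hη28 : η ≤ 1 / 28 := by nlinarith
  have hητ : η * ∑ i ∈ W, (1 / 2 : ℝ) ^ #(V i) ≤ t / 256 := by
    have h1 := mul_le_mul_of_nonneg_left hSW hη0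
    have h2 := mul_le_mul_of_nonneg_right hηkw (show 0 ≤ t by linarith)
    linarith
  -- No leader occurs with probability more than `exp (-t)`; by near independence this caps the
  -- expected number of leaders.
  have hΛ : ∑ i ∈ W, avg (leader W V a i) ≤ t + t / 64 := by
    have h1 := hLD.avg_prod_neg_le_exp hη28 W le_rfl
    have h2 : avg (fun x => ∏ j ∈ W, (1 + -1 * leader W V a j x)) = avg (negF W V a) := by
      congr 1; funext x
      rw [negF_eq_prod_leader]
      exact prod_congr rfl fun j _ => by ring
    rw [h2] at h1
    have h3 := (havg'.trans_le (avg_mono (negF_le_of_subset hWI V a))).trans_le h1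
    rw [Real.exp_lt_exp] at h3
    linarith
  have hmgf : avg (fun x => ∏ i ∈ W, (1 + 7 * leader W V a i x)) ≤ Real.exp (15 * t) := by
    refine (hLD.avg_prod_le_exp hη28 W le_rfl).trans (Real.exp_le_exp.2 ?_)
    linarith
  -- the approximation
  set m := ⌈26 * t⌉₊ with hm
  have hm1 : 26 * t ≤ m := Nat.le_ceil _
  have hm2 : (m : ℝ) ≤ 27 * t := by
    have := Nat.ceil_lt_add_one (show 0 ≤ 26 * t by linarith)
    linarith
  -- With `y = 4 ^ (-w)` the cost `y ^ (-m)` is still `exp (O(w t))`, and `y` beats the crude bound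
  -- `(11/10)^w * 2^w * t` for the sum over the wide terms.
  have hy0 : (0 : ℝ) < (1 / 4) ^ w := by positivity
  have hy1 : (1 / 4 : ℝ) ^ w ≤ 1 := pow_le_one₀ (by norm_num) (by norm_num)
  obtain ⟨g, hg1, hg2⟩ := exists_approx W V a (r := r) (by omega) k (γ := 11 / 20) (by norm_num)
    (by norm_num) (gamma_param k) M (by rw [hWM]; exact hk) m hy0 hy1
  rw [hWM] at hg1
  have h16 : (16 : ℝ) ≤ Real.exp (2 * t) := by
    have : Real.exp (2 * t) = Real.exp t * Real.exp t := by rw [← Real.exp_add]; ring_nf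
    rw [this]; nlinarith
  have happ : avg (fun x => (negF I V a x - g x) ^ 2) ≤ ε / 8 := by
    exact hg1.trans ((mul_le_mul_of_nonneg_left hmgf (by positivity)).trans
      (truncation_param hεt ht1 h16 hm1))
  -- the norm of the approximation
  have hΨ : ∑ i ∈ M.filter (fun i => r < #(V i)), (11 / 20 : ℝ) ^ #(V i) ≤ 220 * (w * t) := by
    -- If `k` is small compared to `w`, the total probability of the terms below `w0` already gives
    -- the bound. Otherwise `log (k w)` is comparable to `log k`, so `w0 ≤ r` and the sum is empty.
    rcases le_total (k ^ 5) w with hc | hc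
    · have h1 : ∀ i ∈ M, (11 / 20 : ℝ) ^ #(V i) ≤ (11 / 10) ^ w0 * (1 / 2) ^ #(V i) :=
        fun i hi => pow_gamma_le (not_le.1 (mem_filter.1 hi).2).le
      have h2 := narrow_cost hk0 hw0 hc
      rw [← hlw, ← hw0def] at h2
      calc _ ≤ ∑ i ∈ M, (11 / 20 : ℝ) ^ #(V i) :=
            sum_le_sum_of_subset_of_nonneg (filter_subset _ _) fun i _ _ => by positivity
        _ ≤ (11 / 10) ^ w0 * ∑ i ∈ M, (1 / 2 : ℝ) ^ #(V i) := by
            rw [mul_sum]; exact sum_le_sum h1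
        _ ≤ (11 / 10) ^ w0 * (k * w0 * t) := mul_le_mul_of_nonneg_left hSM (by positivity)
        _ = (11 / 10) ^ w0 * (k * w0) * t := by ring
        _ ≤ 220 * w * t := mul_le_mul_of_nonneg_right h2 (by linarith)
        _ = _ := by ring
    · have hlw6 : lw ≤ 6 * l := by
        refine Nat.clog_le_of_le_pow ?_
        have h1 : k ≤ 2 ^ l := (Nat.le_add_right k 2).trans (Nat.le_pow_clog (by norm_num) _)
        calc k * w ≤ k * k ^ 5 := Nat.mul_le_mul_left _ hc
          _ = k ^ 6 := by ring
          _ ≤ (2 ^ l) ^ 6 := Nat.pow_le_pow_left h1 6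
          _ = 2 ^ (6 * l) := by rw [← pow_mul, mul_comm]
      have h1 : M.filter (fun i => r < #(V i)) = ∅ := by
        rw [filter_eq_empty_iff]
        intro i hi
        have := not_le.1 (mem_filter.1 hi).2
        omega
      rw [h1, sum_empty]; positivity
  have hyW : (1 / 4 : ℝ) ^ w * ∑ i ∈ W, (11 / 20 : ℝ) ^ #(V i) ≤ t := by
    rcases W.eq_empty_or_nonempty with he | ⟨i0, hi0⟩
    · rw [he]; simp; linarith
    have hw0w : w0 ≤ w := (mem_filter.1 hi0).2.trans (hw i0 (hWI hi0))
    have h1 : (k * w : ℝ) ≤ 2 ^ w := hlw2.trans (pow_le_pow_right₀ (by norm_num) (by omega))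
    have h2 : ∑ i ∈ W, (11 / 20 : ℝ) ^ #(V i) ≤ (11 / 10) ^ w * (2 ^ w * t) := by
      calc _ ≤ (11 / 10) ^ w * ∑ i ∈ W, (1 / 2 : ℝ) ^ #(V i) := by
            rw [mul_sum]; exact sum_le_sum fun i hi => pow_gamma_le (hw i (hWI hi))
        _ ≤ (11 / 10) ^ w * (k * w * t) := mul_le_mul_of_nonneg_left hSW (by positivity)
        _ ≤ _ := mul_le_mul_of_nonneg_left (mul_le_mul_of_nonneg_right h1 (by linarith))
            (by positivity)
    calc _ ≤ (1 / 4 : ℝ) ^ w * ((11 / 10) ^ w * (2 ^ w * t)) :=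
          mul_le_mul_of_nonneg_left h2 (by positivity)
      _ = (11 / 20) ^ w * t := by
          rw [← mul_assoc, ← mul_assoc, ← mul_pow, ← mul_pow]; norm_num
      _ ≤ t := mul_le_of_le_one_left (by linarith) (pow_le_one₀ (by norm_num) (by norm_num))
  set B := Real.exp (260 * (w * t)) with hB
  have hgB : pnorm (1 / (16 * r)) g ≤ B := by
    exact hg2.trans (norm_param hwr ht1 hm2 hΨ hyW)
  -- the tail
  set D := ⌈96 * (w * t)⌉₊ with hD
  have hD1 : 96 * (w * t) ≤ D := Nat.le_ceil _
  have hD2 : (D : ℝ) ≤ 97 * (w * t) := by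
    have := Nat.ceil_lt_add_one (show 0 ≤ 96 * (w * t) by linarith)
    linarith
  have htail : ∑ S ∈ univ.filter (fun S => D < #S), fourierCoef (negF I V a) S ^ 2 ≤ ε / 4 := by
    exact (tail_negF_le hw0 I V a hw D).trans (tail_param hwr hεt h16 hD1)
  have hp1 : (1 / (16 * r) : ℝ) ≤ 1 := by
    rw [div_le_one (by positivity), hr]
    push_cast
    have : (0 : ℝ) ≤ l := by positivity
    linarith
  obtain ⟨𝒮, h𝒮1, h𝒮2⟩ := exists_family (negF I V a) g (p := 1 / (16 * r)) hε (by positivity) hp1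
    (Real.exp_pos _) htail happ hgB
  exact ⟨𝒮, (add_le_add h𝒮1 le_rfl).trans
    (count_le hk0 hX (by linarith) hw0 hεt (Real.exp_pos _) le_rfl hD2), h𝒮2⟩

/-! ### From list formulas to indexed terms -/

/-- The assignment which a term asserts. -/
def termVal {n : ℕ} (T : DNFTerm n) : Cube n := fun v => if (v, -1) ∈ T then -1 else 1

/-- No variable occurs in the term with both signs. -/
def Consistent {n : ℕ} (T : DNFTerm n) : Prop := ∀ v, ¬ ((v, -1) ∈ T ∧ (v, 1) ∈ T)

instance {n : ℕ} : DecidablePred (Consistent (n := n)) := fun T => by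
  unfold Consistent; infer_instance

theorem sat_iff {n : ℕ} (T : DNFTerm n) (x : Cube n) :
    T.Sat x ↔ Consistent T ∧ ∀ v ∈ T.vars, x v = termVal T v := by
  constructor
  · intro h
    refine ⟨fun v hv => ?_, fun v hv => ?_⟩
    · have h1 : x v = -1 := h _ hv.1
      have h2 : x v = 1 := h _ hv.2
      rw [h1] at h2; exact absurd h2 (by decide)
    · obtain ⟨⟨v', b⟩, hl, rfl⟩ := mem_image.1 hv
      have h1 : x v' = b := h _ hl
      unfold termVal
      split_ifs with hm
      · exact h _ hm
      · rcases Int.units_eq_one_or b with rfl | rfl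
        · exact h1
        · exact absurd hl hm
  · rintro ⟨hc, h⟩ ⟨v, b⟩ hl
    have h1 := h v (mem_image.2 ⟨_, hl, rfl⟩)
    simp only [h1, termVal]
    rcases Int.units_eq_one_or b with rfl | rfl
    · rw [if_neg fun hm => hc v ⟨hm, hl⟩]
    · rw [if_pos hl]

/-- Terms are indexed by their positions in the list, so repeated terms stay distinct as in the
definition of read. Inconsistent terms are never satisfied and are dropped. -/
theorem one_sub_toFun_eq {n : ℕ} (F : DNFFormula n) (x : Cube n) :
    1 - F.toFun x = negF (univ.filter fun i : Fin F.length => Consistent (F.get i))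
      (fun i => (F.get i).vars) (fun i => termVal (F.get i)) x := by
  have h : F.Sat x ↔ ∃ i ∈ univ.filter (fun i : Fin F.length => Consistent (F.get i)),
      ¬ tind (F.get i).vars (termVal (F.get i)) x = 0 := by
    unfold DNFFormula.Sat
    simp only [sat_iff, tind, ite_eq_right_iff, one_ne_zero, imp_false, not_not, mem_filter,
      mem_univ, true_and]
    constructor
    · rintro ⟨T, hT, hs⟩
      obtain ⟨i, rfl⟩ := List.get_of_mem hT
      exact ⟨i, hs⟩
    · rintro ⟨i, hs⟩
      exact ⟨F.get i, List.get_mem F i, hs⟩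
  rw [negF_eq_ite]
  unfold DNFFormula.toFun
  by_cases hs : F.Sat x
  · obtain ⟨i, hi, hne⟩ := h.1 hs
    rw [if_pos hs, if_neg fun hall => hne (hall i hi), sub_self]
  · rw [if_neg hs, if_pos, sub_zero]
    intro i hi
    by_contra hne
    exact hs (h.2 ⟨i, hi, hne⟩)

theorem countP_eq_card {n : ℕ} (F : DNFFormula n) (v : Fin n) :
    F.countP (fun T => decide (v ∈ T.vars)) =
      #(univ.filter fun i : Fin F.length => v ∈ (F.get i).vars) := by
  have h := List.ofFn_get F
  conv_lhs => rw [← h]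
  rw [← Multiset.coe_countP, ← Fin.univ_val_map, Multiset.countP_map]
  rfl

theorem fourierCoef_one_sub {n : ℕ} (f : Cube n → ℝ) {S : Finset (Fin n)} (hS : S ≠ ∅) :
    fourierCoef (fun x => 1 - f x) S = -fourierCoef f S := by
  obtain ⟨i, hi⟩ := nonempty_iff_ne_empty.2 hS
  have h : fourierCoef (fun _ : Cube n => (1 : ℝ)) S = 0 := by
    have := fourierCoef_insert_eq_setc (fun _ : Cube n => (1 : ℝ)) (notMem_erase i S)
    rw [insert_erase hi] at this
    rw [this]; unfold setc; simp
  rw [fourierCoef_sub, h, zero_sub]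

end DNFConc

open DNFConc in
theorem mainTheorem3 :
    ∃ C : ℝ, 0 < C ∧
      ∀ (n w k : ℕ) (ε : ℝ) (F : DNFFormula n),
        0 < ε → ε ≤ 1 → DNFFormula.HasWidth F w → DNFFormula.HasRead F k →
          ConcentratedOnCoefs (DNFFormula.toFun F) ε
            (Real.logb 2 ((k : ℝ) + 2) ^ (C * (w : ℝ) * Real.logb 2 (1 / ε))) := by
  refine ⟨6000, by norm_num, fun n w k ε F hε hε1 hw hk => ?_⟩
  set I := Finset.univ.filter fun i : Fin F.length => Consistent (F.get i) with hI
  set V : Fin F.length → Finset (Fin n) := fun i => (F.get i).vars with hV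
  set a : Fin F.length → Cube n := fun i => termVal (F.get i) with ha
  set h := negF I V a with hh
  have hfh : h = fun x => 1 - F.toFun x := funext fun x => (one_sub_toFun_eq F x).symm
  have hcoef : ∀ S : Finset (Fin n), S ≠ ∅ → fourierCoef F.toFun S ^ 2 = fourierCoef h S ^ 2 :=
    fun S hS => by rw [hfh, fourierCoef_one_sub _ hS, neg_sq]
  have hwV : ∀ i ∈ I, (V i).card ≤ w := fun i _ => hw _ (List.get_mem F i)
  have hkV : ∀ v, (I.filter fun i => v ∈ V i).card ≤ k := fun v =>
    (Finset.card_le_card (Finset.filter_subset_filter _ (Finset.subset_univ _))).trans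
      ((countP_eq_card F v).symm.le.trans (hk v))
  have hlg : 1 ≤ Real.logb 2 ((k : ℝ) + 2) := by
    rw [Real.le_logb_iff_rpow_le (by norm_num) (by positivity), Real.rpow_one]
    linarith [Nat.cast_nonneg (α := ℝ) k]
  -- This is the variance of the 0/1-valued `h`, that is, its Fourier weight off `∅`. When it
  -- exceeds `ε`, `h` is not constant, which forces `k, w > 0`, `ε < 1/4` and `ε < avg h`.
  by_cases hq : avg h * (1 - avg h) ≤ ε
  · refine ⟨{∅}, ?_, ?_⟩
    · rw [Finset.card_singleton, Nat.cast_one]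
      refine Real.one_le_rpow hlg (mul_nonneg (by positivity) ?_)
      exact Real.logb_nonneg (by norm_num) (by rw [le_div_iff₀ hε]; linarith)
    · have h1 : ∑ S ∈ ({∅} : Finset (Finset (Fin n)))ᶜ, fourierCoef F.toFun S ^ 2 =
          ∑ S ∈ ({∅} : Finset (Finset (Fin n)))ᶜ, fourierCoef h S ^ 2 :=
        Finset.sum_congr rfl fun S hS => hcoef S (by simpa using hS)
      have h2 := Finset.sum_add_sum_compl {∅} fun S => fourierCoef h S ^ 2
      have h3 : avg (fun x => h x ^ 2) = avg h := by
        congr 1; funext x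
        rw [hh, negF_eq_ite]; split_ifs <;> norm_num
      have h4 : fourierCoef h ∅ = avg h := by simp [fourierCoef, avg, monomialOn]
      rw [Finset.sum_singleton, parseval, h3, h4] at h2
      rw [ConcentratedOnFamily, h1]
      linarith
  · have hconst : (∀ i ∈ I, V i = ∅) → False := by
      intro hemp
      have h1 : h = fun _ => if I = ∅ then 1 else 0 := by
        funext x
        rw [hh]
        split_ifs with hI0
        · rw [hI0]; simp [negF]
        · obtain ⟨i, hi⟩ := Finset.nonempty_iff_ne_empty.2 hI0
          exact Finset.prod_eq_zero hi (by rw [hemp i hi]; simp [tind])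
      rw [h1, avg_const] at hq
      split_ifs at hq <;> norm_num at hq <;> linarith
    have hk0 : 0 < k := by
      rcases Nat.eq_zero_or_pos k with rfl | h0
      · refine (hconst fun i hi => Finset.eq_empty_of_forall_notMem fun v hv => ?_).elim
        have := Finset.card_eq_zero.1 (Nat.le_zero.1 (hkV v))
        exact Finset.notMem_empty i (this ▸ Finset.mem_filter.2 ⟨hi, hv⟩)
      · exact h0
    have hw0 : 0 < w := by
      rcases Nat.eq_zero_or_pos w with rfl | h0
      · exact (hconst fun i hi => Finset.card_eq_zero.1 (Nat.le_zero.1 (hwV i hi))).elim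
      · exact h0
    have hε4 : ε < 1 / 4 := by nlinarith [sq_nonneg (avg h - 1 / 2)]
    have hav : ε < avg h := by nlinarith [sq_nonneg (avg h)]
    obtain ⟨𝒮, h1, h2⟩ := negF_concentrated hk0 hw0 hwV hkV hε hε4 hav
    -- Off `∅` the coefficients of `f` and `1 - f` agree up to sign; adding `∅` uses the `+ 1`
    -- reserved in `negF_concentrated`.
    refine ⟨insert ∅ 𝒮, le_trans ?_ h1, ?_⟩
    · exact_mod_cast Finset.card_insert_le _ _
    · refine le_trans (le_of_eq (Finset.sum_congr rfl fun S hS => hcoef S ?_))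
        ((Finset.sum_le_sum_of_subset_of_nonneg (Finset.compl_subset_compl.2
          (Finset.subset_insert ∅ 𝒮)) fun S _ _ => sq_nonneg _).trans h2)
      rintro rfl
      simp at hS
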